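/- Let $n\ge 1$ and $\vec h\in\mathbb R^n$, and let $\vec\beta_p\in\mathbb R^n$ ($p\ge 2$) satisfy $\sum_{p\ge 2}2^p\vec\beta_p(j)^2<\infty$ for every $j\le n$, $\vec\beta_p=\vec 0$ for odd $p$, and $\vec\beta_p(i)\vec\beta_p(j)\ge 0$ for all $p,i,j$ (for instance, nonnegative inverse temperatures). For an $n\times n$ symmetric matrix $A$ with entries in $[-1,1]$ put, with $\odot$ and $A^{\circ p}$ the Hadamard product and power, $$\xi(A)=\sum_{p\ge2}(\vec\beta_p\vec\beta_p^{\mathsf T})\odot A^{\circ p},\quad \xi'(A)=\sum_{p\ge2}p(\vec\beta_p\vec\beta_p^{\mathsf T})\odot A^{\circ(p-1)},\quad \theta(A)=\sum_{p\ge2}(p-1)(\vec\beta_p\vec\beta_p^{\mathsf T})\odot A^{\circ p}.$$ Write $\langle A,B\rangle=\operatorname{tr}(AB)$, $|A|=\det A$, $\mathrm{Sum}(A)=\sum_{i,j}A_{ij}$, and $A\le B$ if $B-A$ is positive semidefinite. Let $Q$ be a symmetric positive definite $n\times n$ matrix with all diagonal entries equal to $1$. For $r\ge1$ consider sequences $$0=x_0\le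 x_1\le\dots\le x_{r-1}\le 1,\qquad 0=Q_0\le Q_1\le\dots\le Q_{r-1}\le Q_r=Q. \tag{$*$}$$ For a positive semidefinite $\Lambda$ let $\Lambda_p=\Lambda-\sum_{p\le k\le r-1}x_k\big(\xi'(Q_{k+1})-\xi'(Q_k)\big)$ for $1\le p\le r$ (so $\Lambda_r=\Lambda$) and, if $\Lambda_1$ is positive definite, $$\mathscr P_r(\Lambda,x,Q)=\tfrac12\Big[\langle \vec h\vec h^{\mathsf T},\Lambda_1^{-1}\rangle+\langle\Lambda,Q\rangle-n-\log|\Lambda|+\sum_{1\le k\le r-1}\frac1{x_k}\log\frac{|\Lambda_{k+1}|}{|\Lambda_k|}+\langle\xi'(Q_1),\Lambda_1^{-1}\rangle-\sum_{1\le k\le r-1}x_k\,\mathrm{Sum}\big(\theta(Q_{k+1})-\theta(Q_k)\big)\Big].$$ For $r\ge2$ let $D_p=\sum_{p\le k\le r-1}x_k(Q_{k+1}-Q_k)$ for $1\le p\le r-1$ and, if $x_{r-1}=1$ and $|D_{r-1}|=|Q-Q_{r-1}|>0$, $$\mathscr C_r(x,Q)=\tfrac12\Big[\langle \vec h\vec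 h^{\mathsf T},D_1\rangle+\frac1{x_{r-1}}\log|Q-Q_{r-1}|-\sum_{1\le k\le r-2}\frac1{x_k}\log\frac{|D_{k+1}|}{|D_k|}+\langle Q_1,D_1^{-1}\rangle+\sum_{1\le k\le r-1}x_k\,\mathrm{Sum}\big(\xi(Q_{k+1})-\xi(Q_k)\big)\Big].$$ When $x_k=0$, the terms $\frac1{x_k}\log\frac{|\Lambda_{k+1}|}{|\Lambda_k|}$ and $\frac1{x_k}\log\frac{|D_{k+1}|}{|D_k|}$ are read as their limits $\langle\Lambda_k^{-1},\xi'(Q_{k+1})-\xi'(Q_k)\rangle$ and $-\langle D_{k+1}^{-1},Q_{k+1}-Q_k\rangle$ as $x_k\to0$. Theorem. Both infima below are over nonempty sets of real numbers that are bounded below, and $$\inf_{r,\Lambda,x,Q}\mathscr P_r(\Lambda,x,Q)=\inf_{r,x,Q}\mathscr C_r(x,Q),$$ where the first infimum is over all $r\ge1$, all sequences $(*)$ and all positive semidefinite $\Lambda$ such that $\Lambda_1$ is positive definite, and the second is over all $r\ge 2$ and all sequences $(*)$ such that $x_{r-1}=1$ and $|Q-Q_{r-1}|>0$. -/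

import Mathlib

open scoped Matrix

namespace VectorSpin

noncomputable section

/-- The Frobenius inner product `⟨A, B⟩ = tr (A B)` on symmetric matrices. -/
def inn {n : ℕ} (A B : Matrix (Fin n) (Fin n) ℝ) : ℝ := (A * B).trace

/-- The sum of all entries of a matrix. -/
def entrySum {n : ℕ} (A : Matrix (Fin n) (Fin n) ℝ) : ℝ := ∑ i, ∑ j, A i j

/-- `ξ(A) = ∑_{p ≥ 2} (β_p ⊗ β_p) ⊙ A^{∘p}`; the sum over `p ≥ 2` is indexed by `p = m + 2`. -/
def xi {n : ℕ} (β : ℕ → Fin n → ℝ) (A : Matrix (Fin n) (Fin n) ℝ) :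
    Matrix (Fin n) (Fin n) ℝ :=
  Matrix.of fun i j => ∑' m : ℕ, β (m + 2) i * β (m + 2) j * A i j ^ (m + 2)

/-- `ξ'(A) = ∑_{p ≥ 2} p (β_p ⊗ β_p) ⊙ A^{∘(p-1)}`, with `p = m + 2`. -/
def xiDeriv {n : ℕ} (β : ℕ → Fin n → ℝ) (A : Matrix (Fin n) (Fin n) ℝ) :
    Matrix (Fin n) (Fin n) ℝ :=
  Matrix.of fun i j =>
    ∑' m : ℕ, ((m : ℝ) + 2) * (β (m + 2) i * β (m + 2) j) * A i j ^ (m + 1)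

/-- `θ(A) = ∑_{p ≥ 2} (p - 1) (β_p ⊗ β_p) ⊙ A^{∘p}`, with `p = m + 2`. -/
def theta {n : ℕ} (β : ℕ → Fin n → ℝ) (A : Matrix (Fin n) (Fin n) ℝ) :
    Matrix (Fin n) (Fin n) ℝ :=
  Matrix.of fun i j =>
    ∑' m : ℕ, ((m : ℝ) + 1) * (β (m + 2) i * β (m + 2) j) * A i j ^ (m + 2)

/-- The `r`-step sequences
`0 = x_0 ≤ x_1 ≤ ⋯ ≤ x_{r-1} ≤ 1` and `0 = Q_0 ≤ Q_1 ≤ ⋯ ≤ Q_{r-1} ≤ Q_r = Q`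
(matrices are compared in the positive semidefinite order). Only `x k` with `k < r` and
`Qs k` with `k ≤ r` matter. -/
structure IsPath {n : ℕ} (Q : Matrix (Fin n) (Fin n) ℝ) (r : ℕ) (x : ℕ → ℝ)
    (Qs : ℕ → Matrix (Fin n) (Fin n) ℝ) : Prop where
  one_le : 1 ≤ r
  x_zero : x 0 = 0
  x_mono : ∀ k, k + 1 < r → x k ≤ x (k + 1)
  x_le_one : x (r - 1) ≤ 1
  Q_zero : Qs 0 = 0
  Q_mono : ∀ k, k < r → (Qs (k + 1) - Qs k).PosSemidef
  Q_last : Qs r = Q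

/-- `Λ_p = Λ - ∑_{p ≤ k ≤ r-1} x_k (ξ'(Q_{k+1}) - ξ'(Q_k))`; in particular `Λ_r = Λ`. -/
def lagr {n : ℕ} (β : ℕ → Fin n → ℝ) (r : ℕ) (L : Matrix (Fin n) (Fin n) ℝ) (x : ℕ → ℝ)
    (Qs : ℕ → Matrix (Fin n) (Fin n) ℝ) (p : ℕ) : Matrix (Fin n) (Fin n) ℝ :=
  L - ∑ k ∈ Finset.Ico p r, x k • (xiDeriv β (Qs (k + 1)) - xiDeriv β (Qs k))

/-- `D_p = ∑_{p ≤ k ≤ r-1} x_k (Q_{k+1} - Q_k)`. -/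
def dMat {n : ℕ} (r : ℕ) (x : ℕ → ℝ) (Qs : ℕ → Matrix (Fin n) (Fin n) ℝ) (p : ℕ) :
    Matrix (Fin n) (Fin n) ℝ :=
  ∑ k ∈ Finset.Ico p r, x k • (Qs (k + 1) - Qs k)

/-- The term `(1 / x_k) log (|Λ_{k+1}| / |Λ_k|)`. Here `Λ_{k+1} = Λ_k + x_k (ξ'(Q_{k+1}) - ξ'(Q_k))`,
and for `x_k = 0` the term is read as its limit `⟨Λ_k⁻¹, ξ'(Q_{k+1}) - ξ'(Q_k)⟩` as `x_k → 0`. -/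
def parisiLogTerm {n : ℕ} (β : ℕ → Fin n → ℝ) (r : ℕ) (L : Matrix (Fin n) (Fin n) ℝ)
    (x : ℕ → ℝ) (Qs : ℕ → Matrix (Fin n) (Fin n) ℝ) (k : ℕ) : ℝ :=
  if x k = 0 then
    inn (lagr β r L x Qs k)⁻¹ (xiDeriv β (Qs (k + 1)) - xiDeriv β (Qs k))
  else
    1 / x k * Real.log ((lagr β r L x Qs (k + 1)).det / (lagr β r L x Qs k).det)

/-- The term `(1 / x_k) log (|D_{k+1}| / |D_k|)`. Here `D_k = D_{k+1} + x_k (Q_{k+1} - Q_k)`,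
and for `x_k = 0` the term is read as its limit `-⟨D_{k+1}⁻¹, Q_{k+1} - Q_k⟩` as `x_k → 0`. -/
def csLogTerm {n : ℕ} (r : ℕ) (x : ℕ → ℝ) (Qs : ℕ → Matrix (Fin n) (Fin n) ℝ) (k : ℕ) : ℝ :=
  if x k = 0 then
    -inn (dMat r x Qs (k + 1))⁻¹ (Qs (k + 1) - Qs k)
  else
    1 / x k * Real.log ((dMat r x Qs (k + 1)).det / (dMat r x Qs k).det)

/-- The discrete vector Parisi functional `𝒫_r(Λ, x, Q)` (with `Q = Qs r`). -/
def parisi {n : ℕ} (β : ℕ → Fin n → ℝ) (h : Fin n → ℝ) (r : ℕ) (L : Matrix (Fin n) (Fin n) ℝ)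
    (x : ℕ → ℝ) (Qs : ℕ → Matrix (Fin n) (Fin n) ℝ) : ℝ :=
  1 / 2 *
    (inn (Matrix.vecMulVec h h) (lagr β r L x Qs 1)⁻¹
      + inn L (Qs r) - (n : ℝ) - Real.log L.det
      + ∑ k ∈ Finset.Ico 1 r, parisiLogTerm β r L x Qs k
      + inn (xiDeriv β (Qs 1)) (lagr β r L x Qs 1)⁻¹
      - ∑ k ∈ Finset.Ico 1 r, x k * entrySum (theta β (Qs (k + 1)) - theta β (Qs k)))

/-- The discrete vector Crisanti–Sommers functional `𝒞_r(x, Q)` (with `Q = Qs r`), for `r ≥ 2`. -/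
def crisantiSommers {n : ℕ} (β : ℕ → Fin n → ℝ) (h : Fin n → ℝ) (r : ℕ) (x : ℕ → ℝ)
    (Qs : ℕ → Matrix (Fin n) (Fin n) ℝ) : ℝ :=
  1 / 2 *
    (inn (Matrix.vecMulVec h h) (dMat r x Qs 1)
      + 1 / x (r - 1) * Real.log (Qs r - Qs (r - 1)).det
      - ∑ k ∈ Finset.Ico 1 (r - 1), csLogTerm r x Qs k
      + inn (Qs 1) (dMat r x Qs 1)⁻¹
      + ∑ k ∈ Finset.Ico 1 r, x k * entrySum (xi β (Qs (k + 1)) - xi β (Qs k)))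

/-- All values of the Parisi functional: over `r ≥ 1`, all sequences `IsPath Q r x Qs`, and all
positive semidefinite `Λ` such that `Λ_1` is positive definite. -/
def parisiValues {n : ℕ} (β : ℕ → Fin n → ℝ) (h : Fin n → ℝ) (Q : Matrix (Fin n) (Fin n) ℝ) :
    Set ℝ :=
  {v | ∃ (r : ℕ) (L : Matrix (Fin n) (Fin n) ℝ) (x : ℕ → ℝ)
      (Qs : ℕ → Matrix (Fin n) (Fin n) ℝ),
      IsPath Q r x Qs ∧ L.PosSemidef ∧ (lagr β r L x Qs 1).PosDef ∧ v = parisi β h r L x Qs}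

/-- All values of the Crisanti–Sommers functional: over `r` and all sequences `IsPath Q r x Qs`
with `x_{r-1} = 1` (which forces `r ≥ 2`) and `|D_{r-1}| = |Q - Q_{r-1}| > 0`. -/
def csValues {n : ℕ} (β : ℕ → Fin n → ℝ) (h : Fin n → ℝ) (Q : Matrix (Fin n) (Fin n) ℝ) :
    Set ℝ :=
  {v | ∃ (r : ℕ) (x : ℕ → ℝ) (Qs : ℕ → Matrix (Fin n) (Fin n) ℝ),
      IsPath Q r x Qs ∧ x (r - 1) = 1 ∧ 0 < (dMat r x Qs (r - 1)).det ∧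
        v = crisantiSommers β h r x Qs}

end

end VectorSpin

namespace VectorSpin

variable {n : ℕ}

/-! Two dualities link the functionals: Fenchel–Young for `ξ`, with gap `⟨B, ξ'(A)⟩ - Sum θ(A) - Sum
ξ(B) ≤ 0`, and that of the log-determinant, with defect `⟨D, L⟩ - n - log|D| - log|L| ≥ 0`. Take
`Λ_k` driven by a path `Q_k` and `D_k` driven by a path `Q'_k`, with common positive weights, last
weight 1, the same endpoint and `D_1 = Λ_1⁻¹`. Summation by parts writes `2𝒫 - 2𝒞` purely in terms
of increments of gaps, weighted by `x_k`, and of defects, weighted by `1/x_k`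
(`two_mul_parisi_sub_crisantiSommers`).

From 𝒞 to 𝒫 (`IsPath.exists_parisi_le`), keep the path and put `Λ_1 = D_1⁻¹`. The gaps vanish, the
defects are nonnegative and start at 0, and `1/x_k` decreases, so Abel summation gives `𝒫 ≤ 𝒞`.

From 𝒫 to 𝒞 (`IsPath.exists_crisantiSommers_le`), keep the path and the weights and minimize over
`Λ_1`. The path `Q'` defined by `D_k = Λ_k⁻¹` has no defects, and first-order optimality says
precisely that `Q'_1 ≥ 0`, up to discarded terms of the right sign. The gaps are nonpositive and end
at 0, and `x_k` increases, so Abel summation gives `𝒞 ≤ 𝒫`.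

Positive weights with last weight 1 are no restriction: initial zero weights can be dropped, and a
trivial step of weight 1 appended to a Parisi datum. -/

/-! ### Trace pairing, log-determinant and Loewner order. -/

lemma inn_comm (A B : Matrix (Fin n) (Fin n) ℝ) : inn A B = inn B A := Matrix.trace_mul_comm A B

lemma inn_add_left (A B C : Matrix (Fin n) (Fin n) ℝ) : inn (A + B) C = inn A C + inn B C := by
  simp [inn, add_mul]

lemma inn_add_right (A B C : Matrix (Fin n) (Fin n) ℝ) : inn A (B + C) = inn A B + inn A C := by
  simp [inn, mul_add]

lemma inn_sub_left (A B C : Matrix (Fin n) (Fin n) ℝ) : inn (A - B) C = inn A C - inn B C := by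
  simp [inn, sub_mul]

lemma inn_sub_right (A B C : Matrix (Fin n) (Fin n) ℝ) : inn A (B - C) = inn A B - inn A C := by
  simp [inn, mul_sub]

lemma inn_smul_left (c : ℝ) (A B : Matrix (Fin n) (Fin n) ℝ) : inn (c • A) B = c * inn A B := by
  simp [inn]

lemma inn_smul_right (c : ℝ) (A B : Matrix (Fin n) (Fin n) ℝ) : inn A (c • B) = c * inn A B := by
  simp [inn]

lemma inn_zero_left (A : Matrix (Fin n) (Fin n) ℝ) : inn 0 A = 0 := by simp [inn]

lemma inn_vecMulVec (A : Matrix (Fin n) (Fin n) ℝ) (v : Fin n → ℝ) :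
    inn A (Matrix.vecMulVec v v) = v ⬝ᵥ (A *ᵥ v) := by
  rw [inn, Matrix.mul_vecMulVec, Matrix.trace_vecMulVec, dotProduct_comm]

lemma inn_inv_self {A : Matrix (Fin n) (Fin n) ℝ} (hA : A.PosDef) : inn A A⁻¹ = n := by
  rw [inn, Matrix.mul_nonsing_inv _ ((Matrix.isUnit_iff_isUnit_det _).1 hA.isUnit)]
  simp

lemma exists_conjTranspose_mul_self {A : Matrix (Fin n) (Fin n) ℝ} (hA : A.PosSemidef) :
    ∃ S : Matrix (Fin n) (Fin n) ℝ, A = Sᴴ * S := by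
  open scoped MatrixOrder in
  obtain ⟨S, hS⟩ := CStarAlgebra.nonneg_iff_eq_star_mul_self.mp hA.nonneg
  exact ⟨S, hS⟩

lemma inn_nonneg {A B : Matrix (Fin n) (Fin n) ℝ} (hA : A.PosSemidef) (hB : B.PosSemidef) :
    0 ≤ inn A B := by
  obtain ⟨S, rfl⟩ := exists_conjTranspose_mul_self hA
  have := (hB.mul_mul_conjTranspose_same S).trace_nonneg
  rwa [inn, Matrix.mul_assoc, Matrix.trace_mul_comm]

lemma log_det_le_trace_sub {A : Matrix (Fin n) (Fin n) ℝ} (hA : A.PosDef) :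
    Real.log A.det ≤ A.trace - n := by
  rw [hA.1.det_eq_prod_eigenvalues, hA.1.trace_eq_sum_eigenvalues]
  simp only [RCLike.ofReal_real_eq_id, id_eq]
  rw [Real.log_prod (fun i _ => (hA.eigenvalues_pos i).ne')]
  calc _ ≤ ∑ i, (hA.1.eigenvalues i - 1) :=
        Finset.sum_le_sum fun i _ => Real.log_le_sub_one_of_pos (hA.eigenvalues_pos i)
    _ = _ := by simp

/-- With `A = Sᴴ S`, the matrix `S B Sᴴ` is positive definite with determinant `|A||B|` and trace
`⟨A, B⟩`; then `log t ≤ t - 1` applies to its eigenvalues. -/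
lemma log_det_add_log_det_le {A B : Matrix (Fin n) (Fin n) ℝ} (hA : A.PosDef) (hB : B.PosDef) :
    Real.log A.det + Real.log B.det ≤ inn A B - n := by
  obtain ⟨S, hS⟩ := exists_conjTranspose_mul_self hA.posSemidef
  have hdet : A.det * B.det = (S * B * Sᴴ).det := by
    rw [hS]; simp only [Matrix.det_mul]; ring
  have hpos : 0 < (S * B * Sᴴ).det := hdet ▸ mul_pos hA.det_pos hB.det_pos
  have hpd : (S * B * Sᴴ).PosDef :=
    ((hB.posSemidef.mul_mul_conjTranspose_same S).posDef_iff_det_ne_zero).2 hpos.ne'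
  rw [← Real.log_mul hA.det_pos.ne' hB.det_pos.ne', hdet]
  convert log_det_le_trace_sub hpd using 2
  rw [inn, hS, Matrix.mul_assoc, Matrix.trace_mul_comm]

lemma log_det_inv (A : Matrix (Fin n) (Fin n) ℝ) : Real.log A⁻¹.det = -Real.log A.det := by
  rw [Matrix.det_nonsing_inv, Ring.inverse_eq_inv, Real.log_inv]

lemma log_det_mono {A B : Matrix (Fin n) (Fin n) ℝ} (hA : A.PosDef) (hAB : (B - A).PosSemidef) :
    Real.log A.det ≤ Real.log B.det := by
  have hB : B.PosDef := by simpa using hA.add_posSemidef hAB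
  have h1 := log_det_add_log_det_le hA hB.inv
  have h2 := inn_nonneg hAB hB.inv.posSemidef
  rw [inn_sub_left, inn_inv_self hB] at h2
  rw [log_det_inv] at h1
  linarith

/-- The block matrix `[[B, 1], [1, A⁻¹]]` has the two Schur complements `B - A` and `A⁻¹ - B⁻¹`, so
one is positive semidefinite exactly when the other is. -/
lemma inv_antitone {A B : Matrix (Fin n) (Fin n) ℝ} (hA : A.PosDef) (hAB : (B - A).PosSemidef) :
    (A⁻¹ - B⁻¹).PosSemidef := by
  have hB : B.PosDef := by simpa using hA.add_posSemidef hAB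
  have := hA.inv.isUnit.invertible
  have := hB.isUnit.invertible
  have h1 := Matrix.PosDef.fromBlocks₂₂ B (1 : Matrix (Fin n) (Fin n) ℝ) hA.inv
  have h2 := Matrix.PosDef.fromBlocks₁₁ (1 : Matrix (Fin n) (Fin n) ℝ) A⁻¹ hB
  rw [h1] at h2
  have hu := (Matrix.isUnit_iff_isUnit_det _).1 hA.isUnit
  simpa [Matrix.nonsing_inv_nonsing_inv _ hu, hAB] using h2

/-! ### Rank-one perturbations and directional derivatives. -/

lemma det_add_smul_vecMulVec {A : Matrix (Fin n) (Fin n) ℝ} (hA : A.PosDef) (v : Fin n → ℝ)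
    (t : ℝ) : (A + t • Matrix.vecMulVec v v).det = A.det * (1 + t * (v ⬝ᵥ (A⁻¹ *ᵥ v))) := by
  have := Matrix.det_add_replicateCol_mul_replicateRow (ι := Unit)
    ((Matrix.isUnit_iff_isUnit_det _).1 hA.isUnit) (t • v) v
  rw [← Matrix.vecMulVec_eq, Matrix.smul_vecMulVec] at this
  rw [this]
  congr 2
  simp [Matrix.det_unique, Matrix.replicateRow, Matrix.replicateCol, Matrix.mul_apply, dotProduct,
    Matrix.mulVec, Finset.mul_sum, Finset.sum_mul]
  rw [Finset.sum_comm]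
  refine Finset.sum_congr rfl fun i _ => Finset.sum_congr rfl fun j _ => by ring

lemma hasDerivAt_log_det {A : Matrix (Fin n) (Fin n) ℝ} (hA : A.PosDef) (v : Fin n → ℝ) :
    HasDerivAt (fun t : ℝ => Real.log (A + t • Matrix.vecMulVec v v).det)
      (v ⬝ᵥ (A⁻¹ *ᵥ v)) 0 := by
  simp_rw [det_add_smul_vecMulVec hA]
  have h1 : HasDerivAt (fun t : ℝ => A.det * (1 + t * (v ⬝ᵥ (A⁻¹ *ᵥ v))))
      (A.det * (1 * (v ⬝ᵥ (A⁻¹ *ᵥ v)))) 0 :=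
    (((hasDerivAt_id (0 : ℝ)).mul_const _).const_add 1).const_mul _
  have h2 := h1.log (by simp [hA.det_pos.ne'])
  convert h2 using 1
  field_simp [hA.det_pos.ne']
  simp

/-- Sherman–Morrison. Rank-one directions are enough, since semidefiniteness is tested against the
matrices `v vᵀ`. -/
lemma inv_add_smul_vecMulVec {A : Matrix (Fin n) (Fin n) ℝ} (hA : A.PosDef) (v : Fin n → ℝ)
    {t : ℝ} (ht : 1 + t * (v ⬝ᵥ (A⁻¹ *ᵥ v)) ≠ 0) :
    (A + t • Matrix.vecMulVec v v)⁻¹ = A⁻¹ -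
      (t / (1 + t * (v ⬝ᵥ (A⁻¹ *ᵥ v)))) • Matrix.vecMulVec (A⁻¹ *ᵥ v) (A⁻¹ *ᵥ v) := by
  have hu := (Matrix.isUnit_iff_isUnit_det _).1 hA.isUnit
  apply Matrix.inv_eq_right_inv
  have hsym : v ᵥ* A⁻¹ = A⁻¹ *ᵥ v := by
    rw [← Matrix.mulVec_transpose]
    congr 1
    have := hA.inv.1
    rwa [Matrix.IsHermitian, Matrix.conjTranspose_eq_transpose_of_trivial] at this
  have hv : A *ᵥ (A⁻¹ *ᵥ v) = v := by simp [Matrix.mul_nonsing_inv _ hu]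
  simp only [add_mul, mul_sub, Matrix.mul_nonsing_inv _ hu, Matrix.mul_smul, Matrix.smul_mul,
    Matrix.mul_vecMulVec, Matrix.vecMulVec_mul, hv, hsym]
  set c := v ⬝ᵥ (A⁻¹ *ᵥ v)
  have hw : (t • Matrix.vecMulVec v v) *ᵥ A⁻¹ *ᵥ v = (t * c) • v := by
    rw [Matrix.smul_mulVec, Matrix.vecMulVec_mulVec, op_smul_eq_smul, smul_smul]
  rw [hw, Matrix.smul_vecMulVec, smul_smul, add_sub_assoc, ← add_smul, ← sub_smul]
  convert add_zero _
  convert zero_smul ℝ _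
  field_simp
  ring

lemma hasDerivAt_inn_inv {A : Matrix (Fin n) (Fin n) ℝ} (hA : A.PosDef) (v : Fin n → ℝ)
    (W : Matrix (Fin n) (Fin n) ℝ) :
    HasDerivAt (fun t : ℝ => inn W (A + t • Matrix.vecMulVec v v)⁻¹)
      (-((A⁻¹ *ᵥ v) ⬝ᵥ (W *ᵥ (A⁻¹ *ᵥ v)))) 0 := by
  set c := v ⬝ᵥ (A⁻¹ *ᵥ v) with hc
  set w := (A⁻¹ *ᵥ v) ⬝ᵥ (W *ᵥ (A⁻¹ *ᵥ v)) with hw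
  have h1 : HasDerivAt (fun t : ℝ => inn W A⁻¹ - t / (1 + t * c) * w)
      (-((1 * (1 + 0 * c) - 0 * (1 * c)) / (1 + 0 * c) ^ 2 * w)) 0 :=
    ((((hasDerivAt_id (0 : ℝ)).fun_div (((hasDerivAt_id (0 : ℝ)).mul_const c).const_add 1)
      (by simp)).mul_const w).const_sub _)
  have h2 : (fun t : ℝ => inn W (A + t • Matrix.vecMulVec v v)⁻¹) =ᶠ[nhds 0]
      fun t : ℝ => inn W A⁻¹ - t / (1 + t * c) * w := by
    have hcont : Continuous fun t : ℝ => 1 + t * c := by fun_prop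
    have : ∀ᶠ t in nhds (0 : ℝ), 1 + t * c ≠ 0 :=
      hcont.continuousAt.eventually_ne (by simp)
    filter_upwards [this] with t ht
    rw [inv_add_smul_vecMulVec hA v ht, inn_sub_right, inn_smul_right, inn_vecMulVec]
  simpa using h1.congr_of_eventuallyEq h2

/-! ### Coercivity and existence of minimizers. -/

lemma dotProduct_mulVec_le_trace {A : Matrix (Fin n) (Fin n) ℝ} (hA : A.PosSemidef)
    (v : Fin n → ℝ) : v ⬝ᵥ (A *ᵥ v) ≤ A.trace * (v ⬝ᵥ v) := by
  have h : ((v ⬝ᵥ v) • (1 : Matrix (Fin n) (Fin n) ℝ) - Matrix.vecMulVec v v).PosSemidef := by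
    refine Matrix.PosSemidef.of_dotProduct_mulVec_nonneg ?_ fun w => ?_
    · ext i j
      simp [Matrix.vecMulVec_apply, Matrix.one_apply, eq_comm, mul_comm]
    · have := Finset.sum_mul_sq_le_sq_mul_sq Finset.univ v w
      simp only [Matrix.sub_mulVec, Matrix.smul_mulVec, Matrix.one_mulVec, dotProduct_sub,
        Matrix.vecMulVec_mulVec, star_trivial, dotProduct_smul, smul_eq_mul,
        MulOpposite.smul_eq_mul_unop, MulOpposite.unop_op]
      rw [dotProduct_comm w v]
      simp only [dotProduct, ← sq]
      linarith
  have := inn_nonneg hA h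
  rw [inn_sub_right, inn_smul_right, inn_vecMulVec] at this
  simp only [inn, mul_one] at this
  linarith

lemma exists_pos_mul_trace_le {Q : Matrix (Fin n) (Fin n) ℝ} (hQ : Q.PosDef) :
    ∃ q : ℝ, 0 < q ∧ ∀ M : Matrix (Fin n) (Fin n) ℝ, M.PosSemidef → q * M.trace ≤ inn M Q := by
  -- `Q⁻¹ ≤ (tr Q⁻¹) 1`, and inversion gives `K⁻¹ 1 ≤ Q`. The added 1 keeps `K` positive even in
  -- dimension 0.
  set K := Q⁻¹.trace + 1 with hK
  have hK0 : 0 < K := by linarith [hQ.inv.posSemidef.trace_nonneg]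
  have h1 : (K • (1 : Matrix (Fin n) (Fin n) ℝ) - Q⁻¹).PosSemidef := by
    refine Matrix.PosSemidef.of_dotProduct_mulVec_nonneg
      (((Matrix.PosDef.one).smul hK0).1.sub hQ.inv.1) fun w => ?_
    have h2 := dotProduct_mulVec_le_trace hQ.inv.posSemidef w
    have h3 : 0 ≤ w ⬝ᵥ w := by simpa using dotProduct_star_self_nonneg w
    simp only [Matrix.sub_mulVec, Matrix.smul_mulVec, Matrix.one_mulVec, dotProduct_sub,
        star_trivial, dotProduct_smul, smul_eq_mul]
    rw [hK]
    linarith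
  have h2 := inv_antitone hQ.inv h1
  rw [Matrix.nonsing_inv_nonsing_inv _ ((Matrix.isUnit_iff_isUnit_det _).1 hQ.isUnit)] at h2
  have h3 : (K • (1 : Matrix (Fin n) (Fin n) ℝ))⁻¹ = K⁻¹ • 1 := by
    apply Matrix.inv_eq_right_inv
    simp [smul_smul, hK0.ne']
  rw [h3] at h2
  refine ⟨K⁻¹, inv_pos.2 hK0, fun M hM => ?_⟩
  have := inn_nonneg hM h2
  rw [inn_sub_right, inn_smul_right] at this
  simp only [inn, mul_one] at this ⊢
  linarith

lemma abs_apply_le {M : Matrix (Fin n) (Fin n) ℝ} (hM : M.PosSemidef) (i j : Fin n) :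
    |M i j| ≤ (M i i + M j j) / 2 := by
  have hs : M j i = M i j := by simpa using hM.1.apply i j
  have h1 := hM.dotProduct_mulVec_nonneg (Pi.single i 1 + Pi.single j 1)
  have h2 := hM.dotProduct_mulVec_nonneg (Pi.single i 1 - Pi.single j 1)
  simp [Matrix.mulVec_add, Matrix.mulVec_sub] at h1 h2
  rw [abs_le]
  constructor <;> linarith

lemma abs_apply_le_trace {M : Matrix (Fin n) (Fin n) ℝ} (hM : M.PosSemidef) (i j : Fin n) :
    |M i j| ≤ M.trace := by
  have h : ∀ i, M i i ≤ M.trace := fun i =>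
    Finset.single_le_sum (f := fun i => M i i) (fun k _ => hM.diag_nonneg) (Finset.mem_univ i)
  linarith [abs_apply_le hM i j, h i, h j]

lemma isCompact_setOf_trace_le_det_ge (K d : ℝ) :
    IsCompact {M : Matrix (Fin n) (Fin n) ℝ | M.PosSemidef ∧ M.trace ≤ K ∧ d ≤ M.det} := by
  have hb : IsCompact (Set.pi Set.univ fun _ : Fin n => Set.pi Set.univ fun _ : Fin n =>
      Set.Icc (-K) K) := isCompact_univ_pi fun _ => isCompact_univ_pi fun _ => isCompact_Icc
  refine hb.of_isClosed_subset ?_ ?_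
  · have h1 : {M : Matrix (Fin n) (Fin n) ℝ | M.PosSemidef ∧ M.trace ≤ K ∧ d ≤ M.det} =
        {M | Mᴴ = M} ∩ (⋂ v : Fin n → ℝ, {M | 0 ≤ star v ⬝ᵥ (M *ᵥ v)}) ∩
          ({M | M.trace ≤ K} ∩ {M | d ≤ M.det}) := by
      ext M
      simp [Matrix.posSemidef_iff_dotProduct_mulVec, Matrix.IsHermitian]
    rw [h1]
    refine ((isClosed_eq (by fun_prop) continuous_id).inter
      (isClosed_iInter fun v => isClosed_le continuous_const (by fun_prop))).inter
      ((isClosed_le (by fun_prop) continuous_const).inter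
        (isClosed_le continuous_const (by fun_prop)))
  · rintro M ⟨h1, h2, -⟩
    exact fun i _ j _ => abs_le.1 ((abs_apply_le_trace h1 i j).trans h2)

lemma continuousOn_inv : ContinuousOn (fun M : Matrix (Fin n) (Fin n) ℝ => M⁻¹)
    {M | M.det ≠ 0} := by
  simp only [Matrix.inv_def, Ring.inverse_eq_inv]
  exact ((Continuous.matrix_det continuous_id).continuousOn.inv₀ fun M hM => hM).smul
    (Continuous.matrix_adjugate continuous_id).continuousOn

/-- A function on the positive definite cone that is continuous and dominates
`⟨M, Q⟩ - log |M|` up to a constant attains its minimum. -/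
lemma exists_min_of_coercive {Q : Matrix (Fin n) (Fin n) ℝ} (hQ : Q.PosDef)
    (f : Matrix (Fin n) (Fin n) ℝ → ℝ) (hf : ContinuousOn f {M | M.PosDef}) (c : ℝ)
    (hc : ∀ M, M.PosDef → inn M Q - Real.log M.det + c ≤ f M) :
    ∃ M : Matrix (Fin n) (Fin n) ℝ, M.PosDef ∧ ∀ M', M'.PosDef → f M ≤ f M' := by
  obtain ⟨q, hq, hqM⟩ := exists_pos_mul_trace_le hQ
  have h2 : (0 : ℝ) < 1 / 2 := by norm_num
  set F := f 1
  -- The log-determinant inequality for `M` and `Q/2` costs only half of `⟨M, Q⟩`; the other half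
  -- bounds the trace on the sublevel set of `f 1`.
  set a := (n : ℝ) + Real.log ((1 / 2 : ℝ) • Q).det with ha
  have hlow : ∀ M : Matrix (Fin n) (Fin n) ℝ, M.PosDef → f M ≤ F →
      inn M Q ≤ 2 * (F - c - a) ∧ -(F - c) ≤ Real.log M.det := by
    intro M hM hF
    have h3 := hc M hM
    have h4 := log_det_add_log_det_le hM (hQ.smul h2)
    have h5 := inn_nonneg hM.posSemidef hQ.posSemidef
    rw [inn_smul_right] at h4
    constructor <;> linarith
  set S := {M : Matrix (Fin n) (Fin n) ℝ | M.PosSemidef ∧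
    M.trace ≤ 2 * (F - c - a) / q ∧ Real.exp (-(F - c)) ≤ M.det} with hS
  have hmem : ∀ M : Matrix (Fin n) (Fin n) ℝ, M.PosDef → f M ≤ F → M ∈ S := by
    intro M hM hF
    obtain ⟨h3, h4⟩ := hlow M hM hF
    refine ⟨hM.posSemidef, ?_, ?_⟩
    · rw [le_div_iff₀ hq]
      linarith [hqM M hM.posSemidef]
    · rwa [Real.le_log_iff_exp_le hM.det_pos] at h4
  have hpd : ∀ M ∈ S, M.PosDef := fun M hM =>
    (hM.1.posDef_iff_det_ne_zero).2 ((Real.exp_pos _).trans_le hM.2.2).ne'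
  have h1 : (1 : Matrix (Fin n) (Fin n) ℝ).PosDef := Matrix.PosDef.one
  obtain ⟨M, hM, hmin⟩ := (isCompact_setOf_trace_le_det_ge _ _).exists_isMinOn
    ⟨1, hmem 1 h1 le_rfl⟩ (hf.mono hpd)
  refine ⟨M, hpd M hM, fun M' hM' => ?_⟩
  rcases le_total (f M') F with h | h
  · exact hmin (hmem M' hM' h)
  · exact (hmin (hmem 1 h1 le_rfl)).trans h

/-! ### The series for `ξ`, `ξ'`, `θ` and the Fenchel–Young inequality. -/

lemma summable_two_pow_mul_abs {β : ℕ → Fin n → ℝ}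
    (hβ : ∀ j, Summable fun p : ℕ => (2 : ℝ) ^ p * β p j ^ 2) (i j : Fin n) :
    Summable fun m : ℕ => (2 : ℝ) ^ (m + 2) * |β (m + 2) i * β (m + 2) j| := by
  have h : Summable fun p : ℕ => (2 : ℝ) ^ p * |β p i * β p j| := by
    refine Summable.of_nonneg_of_le (fun p => by positivity) (fun p => ?_)
      ((hβ i).add (hβ j))
    rw [← mul_add, abs_mul]
    gcongr
    nlinarith [sq_nonneg (|β p i| - |β p j|), sq_abs (β p i), sq_abs (β p j),
      sq_nonneg (|β p i|), sq_nonneg (|β p j|)]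
  exact (summable_nat_add_iff 2).2 h

lemma summable_coeff_mul_pow {β : ℕ → Fin n → ℝ}
    (hβ : ∀ j, Summable fun p : ℕ => (2 : ℝ) ^ p * β p j ^ 2) (i j : Fin n) {a : ℝ} (ha : |a| ≤ 1)
    (c : ℕ → ℝ) (hc : ∀ m, |c m| ≤ 2 ^ (m + 2)) (e : ℕ → ℕ) :
    Summable fun m : ℕ => c m * (β (m + 2) i * β (m + 2) j) * a ^ e m := by
  refine Summable.of_norm_bounded (summable_two_pow_mul_abs hβ i j) fun m => ?_
  rw [Real.norm_eq_abs, abs_mul, abs_mul, abs_pow]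
  calc _ ≤ |c m| * |β (m + 2) i * β (m + 2) j| * 1 := by
        gcongr
        exact pow_le_one₀ (abs_nonneg _) ha
    _ ≤ _ := by rw [mul_one]; gcongr; exact hc m

lemma natCast_add_two_le (m : ℕ) : (m : ℝ) + 2 ≤ 2 ^ (m + 2) := by
  exact_mod_cast (Nat.lt_two_pow_self (n := m + 2)).le

lemma hasSum_xi {β : ℕ → Fin n → ℝ}
    (hβ : ∀ j, Summable fun p : ℕ => (2 : ℝ) ^ p * β p j ^ 2) {A : Matrix (Fin n) (Fin n) ℝ}
    {i j : Fin n} (hA : |A i j| ≤ 1) :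
    HasSum (fun m : ℕ => β (m + 2) i * β (m + 2) j * A i j ^ (m + 2)) (xi β A i j) := by
  have := summable_coeff_mul_pow hβ i j hA (fun _ => 1)
    (fun m => by simpa using one_le_pow₀ one_le_two) (fun m => m + 2)
  simp only [one_mul] at this
  exact this.hasSum

lemma hasSum_xiDeriv {β : ℕ → Fin n → ℝ}
    (hβ : ∀ j, Summable fun p : ℕ => (2 : ℝ) ^ p * β p j ^ 2) {A : Matrix (Fin n) (Fin n) ℝ}
    {i j : Fin n} (hA : |A i j| ≤ 1) :
    HasSum (fun m : ℕ => ((m : ℝ) + 2) * (β (m + 2) i * β (m + 2) j) * A i j ^ (m + 1))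
      (xiDeriv β A i j) :=
  (summable_coeff_mul_pow hβ i j hA (fun m => (m : ℝ) + 2)
    (fun m => by rw [abs_of_nonneg (by positivity)]; exact natCast_add_two_le m) _).hasSum

lemma hasSum_theta {β : ℕ → Fin n → ℝ}
    (hβ : ∀ j, Summable fun p : ℕ => (2 : ℝ) ^ p * β p j ^ 2) {A : Matrix (Fin n) (Fin n) ℝ}
    {i j : Fin n} (hA : |A i j| ≤ 1) :
    HasSum (fun m : ℕ => ((m : ℝ) + 1) * (β (m + 2) i * β (m + 2) j) * A i j ^ (m + 2))
      (theta β A i j) :=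
  (summable_coeff_mul_pow hβ i j hA (fun m => (m : ℝ) + 1)
    (fun m => by
      rw [abs_of_nonneg (by positivity)]
      linarith [natCast_add_two_le m]) _).hasSum

/-- The graph of `t ↦ t ^ p`, for `p = m + 2` even, lies above its tangent at `a`. After division by
`a ^ p` this is Bernoulli's inequality at `b / a - 1`; below `-2`, evenness replaces Bernoulli. -/
lemma mul_pow_mul_le_of_even {m : ℕ} (hm : Even (m + 2)) (a b : ℝ) :
    ((m : ℝ) + 2) * a ^ (m + 1) * b ≤ ((m : ℝ) + 1) * a ^ (m + 2) + b ^ (m + 2) := by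
  rcases eq_or_ne a 0 with rfl | ha
  · simpa using hm.pow_nonneg b
  · have h1 : ∀ t : ℝ, 1 + ((m : ℝ) + 2) * t ≤ (1 + t) ^ (m + 2) := by
      intro t
      rcases le_total (-2) t with ht | ht
      · simpa using one_add_mul_le_pow ht (m + 2)
      · have := hm.pow_nonneg (1 + t)
        nlinarith [(Nat.cast_nonneg m : (0 : ℝ) ≤ m)]
    have h2 := h1 (b / a - 1)
    rw [add_sub_cancel, div_pow, le_div_iff₀ (hm.pow_pos ha)] at h2
    have h3 : (1 + ((m : ℝ) + 2) * (b / a - 1)) * a ^ (m + 2) =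
        ((m : ℝ) + 2) * a ^ (m + 1) * b - ((m : ℝ) + 1) * a ^ (m + 2) := by
      field_simp
      ring
    linarith

lemma entrySum_sub (A B : Matrix (Fin n) (Fin n) ℝ) :
    entrySum (A - B) = entrySum A - entrySum B := by
  simp [entrySum, Finset.sum_sub_distrib]

lemma inn_eq_sum_of_isSymm (A : Matrix (Fin n) (Fin n) ℝ) {B : Matrix (Fin n) (Fin n) ℝ}
    (hB : B.IsSymm) : inn A B = ∑ i, ∑ j, A i j * B i j := by
  simp only [inn, Matrix.trace, Matrix.diag, Matrix.mul_apply]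
  exact Finset.sum_congr rfl fun i _ => Finset.sum_congr rfl fun j _ => by rw [hB.apply]

lemma isSymm_xiDeriv (β : ℕ → Fin n → ℝ) {A : Matrix (Fin n) (Fin n) ℝ} (hA : A.IsSymm) :
    (xiDeriv β A).IsSymm := by
  ext i j
  simp only [xiDeriv, Matrix.transpose_apply, Matrix.of_apply, hA.apply i j,
    mul_comm (β _ i) (β _ j)]

/-- The equality case of Fenchel–Young, from `p = (p - 1) + 1` in each degree. -/
lemma inn_xiDeriv_self {β : ℕ → Fin n → ℝ}
    (hβ : ∀ j, Summable fun p : ℕ => (2 : ℝ) ^ p * β p j ^ 2) {A : Matrix (Fin n) (Fin n) ℝ}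
    (hA : A.IsSymm) (hA1 : ∀ i j, |A i j| ≤ 1) :
    inn A (xiDeriv β A) = entrySum (theta β A) + entrySum (xi β A) := by
  rw [inn_eq_sum_of_isSymm _ (isSymm_xiDeriv β hA), entrySum, entrySum,
    ← Finset.sum_add_distrib]
  refine Finset.sum_congr rfl fun i _ => ?_
  rw [← Finset.sum_add_distrib]
  refine Finset.sum_congr rfl fun j _ => ?_
  refine HasSum.unique (f := fun m : ℕ => A i j *
    (((m : ℝ) + 2) * (β (m + 2) i * β (m + 2) j) * A i j ^ (m + 1)))
    ((hasSum_xiDeriv hβ (hA1 i j)).mul_left (A i j)) ?_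
  have h := (hasSum_theta hβ (hA1 i j)).add (hasSum_xi hβ (hA1 i j))
  refine h.congr_fun fun m => ?_
  ring

/-- The Fenchel–Young inequality for the convex function `ξ`. -/
lemma inn_xiDeriv_le {β : ℕ → Fin n → ℝ}
    (hβ : ∀ j, Summable fun p : ℕ => (2 : ℝ) ^ p * β p j ^ 2)
    (hβ_odd : ∀ p, 2 ≤ p → Odd p → β p = 0)
    (hβ_sign : ∀ p, 2 ≤ p → ∀ i j, 0 ≤ β p i * β p j) {A B : Matrix (Fin n) (Fin n) ℝ}
    (hA : A.IsSymm) (hA1 : ∀ i j, |A i j| ≤ 1) (hB1 : ∀ i j, |B i j| ≤ 1) :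
    inn B (xiDeriv β A) ≤ entrySum (theta β A) + entrySum (xi β B) := by
  rw [inn_eq_sum_of_isSymm _ (isSymm_xiDeriv β hA), entrySum, entrySum,
    ← Finset.sum_add_distrib]
  refine Finset.sum_le_sum fun i _ => ?_
  rw [← Finset.sum_add_distrib]
  refine Finset.sum_le_sum fun j _ => ?_
  refine hasSum_le (fun m => ?_) ((hasSum_xiDeriv hβ (hA1 i j)).mul_left (B i j))
    ((hasSum_theta hβ (hA1 i j)).add (hasSum_xi hβ (hB1 i j)))
  rcases Nat.even_or_odd (m + 2) with hm | hm
  · have h1 := mul_le_mul_of_nonneg_left (mul_pow_mul_le_of_even hm (A i j) (B i j))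
      (hβ_sign (m + 2) (by omega) i j)
    linarith
  · simp [hβ_odd (m + 2) (by omega) hm]

lemma entrySum_theta_nonneg {β : ℕ → Fin n → ℝ}
    (hβ_odd : ∀ p, 2 ≤ p → Odd p → β p = 0)
    (hβ_sign : ∀ p, 2 ≤ p → ∀ i j, 0 ≤ β p i * β p j) (A : Matrix (Fin n) (Fin n) ℝ) :
    0 ≤ entrySum (theta β A) := by
  refine Finset.sum_nonneg fun i _ => Finset.sum_nonneg fun j _ => tsum_nonneg fun m => ?_
  rcases Nat.even_or_odd (m + 2) with hm | hm
  · exact mul_nonneg (mul_nonneg (by positivity) (hβ_sign _ (by omega) i j)) (hm.pow_nonneg _)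
  · simp [hβ_odd (m + 2) (by omega) hm]

/-! ### Monotonicity of `ξ'` in the Loewner order. -/

lemma isSymm_of_isHermitian {A : Matrix (Fin n) (Fin n) ℝ} (hA : A.IsHermitian) : A.IsSymm :=
  (Matrix.conjTranspose_eq_transpose_of_trivial A).symm.trans hA

lemma posSemidef_hadamard {A B : Matrix (Fin n) (Fin n) ℝ} (hA : A.PosSemidef)
    (hB : B.PosSemidef) : (A ⊙ B).PosSemidef := hA.hadamard hB

lemma posSemidef_map_pow {A : Matrix (Fin n) (Fin n) ℝ} (hA : A.PosSemidef) (k : ℕ) :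
    (A.map (· ^ k)).PosSemidef := by
  induction k with
  | zero =>
    convert Matrix.posSemidef_vecMulVec_self_star (fun _ : Fin n => (1 : ℝ)) using 1
    ext i j
    simp [Matrix.vecMulVec_apply]
  | succ k ih =>
    convert posSemidef_hadamard ih hA using 1
    ext i j
    simp [pow_succ]

/-- Induction through `B^{∘(k+1)} - A^{∘(k+1)} = B^{∘k} ⊙ (B - A) + (B^{∘k} - A^{∘k}) ⊙ A` and the
Schur product theorem. -/
lemma posSemidef_map_pow_sub {A B : Matrix (Fin n) (Fin n) ℝ} (hA : A.PosSemidef)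
    (hAB : (B - A).PosSemidef) (k : ℕ) : (B.map (· ^ k) - A.map (· ^ k)).PosSemidef := by
  have hB : B.PosSemidef := by simpa using hAB.add hA
  induction k with
  | zero => simpa [Matrix.map] using Matrix.PosSemidef.zero
  | succ k ih =>
    convert (posSemidef_hadamard (posSemidef_map_pow hB k) hAB).add
      (posSemidef_hadamard ih hA) using 1
    ext i j
    simp [pow_succ]
    ring

lemma posSemidef_xiDeriv_sub {β : ℕ → Fin n → ℝ}
    (hβ : ∀ j, Summable fun p : ℕ => (2 : ℝ) ^ p * β p j ^ 2) {A B : Matrix (Fin n) (Fin n) ℝ}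
    (hA : A.PosSemidef) (hAB : (B - A).PosSemidef) (hA1 : ∀ i j, |A i j| ≤ 1)
    (hB1 : ∀ i j, |B i j| ≤ 1) : (xiDeriv β B - xiDeriv β A).PosSemidef := by
  have hB : B.PosSemidef := by simpa using hAB.add hA
  have hAs : A.IsSymm := isSymm_of_isHermitian hA.1
  have hBs : B.IsSymm := isSymm_of_isHermitian hB.1
  refine Matrix.PosSemidef.of_dotProduct_mulVec_nonneg ?_ fun v => ?_
  · exact (Matrix.conjTranspose_eq_transpose_of_trivial _).trans
      ((isSymm_xiDeriv β hBs).sub (isSymm_xiDeriv β hAs))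
  · have h1 : HasSum (fun m : ℕ => ∑ i, v i * ∑ j,
        (((m : ℝ) + 2) * (β (m + 2) i * β (m + 2) j) * B i j ^ (m + 1) -
          ((m : ℝ) + 2) * (β (m + 2) i * β (m + 2) j) * A i j ^ (m + 1)) * v j)
        (∑ i, v i * ∑ j, (xiDeriv β B i j - xiDeriv β A i j) * v j) :=
      hasSum_sum fun i _ => (hasSum_sum fun j _ =>
        ((hasSum_xiDeriv hβ (hB1 i j)).sub (hasSum_xiDeriv hβ (hA1 i j))).mul_right _).mul_left _
    refine h1.nonneg fun m => ?_
    have h2 := ((posSemidef_hadamard (Matrix.posSemidef_vecMulVec_self_star (β (m + 2)))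
      (posSemidef_map_pow_sub hA hAB (m + 1))).smul
      (show (0 : ℝ) ≤ (m : ℝ) + 2 by positivity)).dotProduct_mulVec_nonneg v
    convert h2 using 1
    simp only [dotProduct, Matrix.mulVec, star_trivial, Matrix.smul_apply, Matrix.hadamard_apply,
      Matrix.vecMulVec_apply, Matrix.sub_apply, Matrix.map_apply, smul_eq_mul]
    refine Finset.sum_congr rfl fun i _ => ?_
    congr 1
    exact Finset.sum_congr rfl fun j _ => by ring

lemma xiDeriv_zero (β : ℕ → Fin n → ℝ) : xiDeriv β 0 = 0 := by
  ext i j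
  simp [xiDeriv]

/-! ### Elementary properties of paths. -/

/-- Along a path, `Q_k` is dominated by `Q_l` for `k ≤ l ≤ r`. -/
lemma IsPath.sub_posSemidef {Q : Matrix (Fin n) (Fin n) ℝ} {r : ℕ} {x : ℕ → ℝ}
    {Qs : ℕ → Matrix (Fin n) (Fin n) ℝ} (hp : IsPath Q r x Qs) {k l : ℕ} (hkl : k ≤ l)
    (hl : l ≤ r) : (Qs l - Qs k).PosSemidef := by
  induction l, hkl using Nat.le_induction with
  | base => simpa using Matrix.PosSemidef.zero
  | succ l _ ih => simpa using (hp.Q_mono l (by omega)).add (ih (by omega))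

lemma IsPath.posSemidef {Q : Matrix (Fin n) (Fin n) ℝ} {r : ℕ} {x : ℕ → ℝ}
    {Qs : ℕ → Matrix (Fin n) (Fin n) ℝ} (hp : IsPath Q r x Qs) {k : ℕ} (hk : k ≤ r) :
    (Qs k).PosSemidef := by
  simpa [hp.Q_zero] using hp.sub_posSemidef (Nat.zero_le k) hk

lemma IsPath.isSymm {Q : Matrix (Fin n) (Fin n) ℝ} {r : ℕ} {x : ℕ → ℝ}
    {Qs : ℕ → Matrix (Fin n) (Fin n) ℝ} (hp : IsPath Q r x Qs) {k : ℕ} (hk : k ≤ r) :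
    (Qs k).IsSymm := 
  isSymm_of_isHermitian (hp.posSemidef hk).1

/-- Diagonal entries are at most those of `Q` and control the others by semidefiniteness; hence the
series converge along the whole path. -/
lemma IsPath.abs_apply_le_one {Q : Matrix (Fin n) (Fin n) ℝ} (hQ : ∀ j, Q j j = 1) {r : ℕ}
    {x : ℕ → ℝ} {Qs : ℕ → Matrix (Fin n) (Fin n) ℝ} (hp : IsPath Q r x Qs) {k : ℕ} (hk : k ≤ r)
    (i j : Fin n) : |Qs k i j| ≤ 1 := by
  have h : ∀ i, Qs k i i ≤ 1 := fun i => by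
    have := (hp.sub_posSemidef hk le_rfl).diag_nonneg (i := i)
    rw [hp.Q_last, Matrix.sub_apply, hQ] at this
    linarith
  linarith [abs_apply_le (hp.posSemidef hk) i j, h i, h j]

lemma IsPath.xiDeriv_sub_posSemidef {β : ℕ → Fin n → ℝ}
    (hβ : ∀ j, Summable fun p : ℕ => (2 : ℝ) ^ p * β p j ^ 2)
    {Q : Matrix (Fin n) (Fin n) ℝ} (hQ : ∀ j, Q j j = 1) {r : ℕ} {x : ℕ → ℝ}
    {Qs : ℕ → Matrix (Fin n) (Fin n) ℝ} (hp : IsPath Q r x Qs) {k : ℕ} (hk : k < r) :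
    (xiDeriv β (Qs (k + 1)) - xiDeriv β (Qs k)).PosSemidef :=
  posSemidef_xiDeriv_sub hβ (hp.posSemidef hk.le) (hp.Q_mono k hk)
    (hp.abs_apply_le_one hQ hk.le) (hp.abs_apply_le_one hQ hk)

lemma IsPath.x_monotone {Q : Matrix (Fin n) (Fin n) ℝ} {r : ℕ} {x : ℕ → ℝ}
    {Qs : ℕ → Matrix (Fin n) (Fin n) ℝ} (hp : IsPath Q r x Qs) {k l : ℕ} (hkl : k ≤ l)
    (hl : l < r) : x k ≤ x l := by
  induction l, hkl using Nat.le_induction with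
  | base => exact le_rfl
  | succ l _ ih => exact (ih (by omega)).trans (hp.x_mono l hl)

lemma IsPath.x_le {Q : Matrix (Fin n) (Fin n) ℝ} {r : ℕ} {x : ℕ → ℝ}
    {Qs : ℕ → Matrix (Fin n) (Fin n) ℝ} (hp : IsPath Q r x Qs) {k : ℕ} (hk : k < r) :
    x k ≤ 1 := (hp.x_monotone (by omega : k ≤ r - 1) (by omega)).trans hp.x_le_one

lemma IsPath.x_nonneg {Q : Matrix (Fin n) (Fin n) ℝ} {r : ℕ} {x : ℕ → ℝ}
    {Qs : ℕ → Matrix (Fin n) (Fin n) ℝ} (hp : IsPath Q r x Qs) {k : ℕ} (hk : k < r) :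
    0 ≤ x k := hp.x_zero ▸ hp.x_monotone (Nat.zero_le k) hk

lemma lagr_last (β : ℕ → Fin n → ℝ) (r : ℕ) (L : Matrix (Fin n) (Fin n) ℝ) (x : ℕ → ℝ)
    (Qs : ℕ → Matrix (Fin n) (Fin n) ℝ) : lagr β r L x Qs r = L := by simp [lagr]

lemma lagr_succ (β : ℕ → Fin n → ℝ) {r : ℕ} (L : Matrix (Fin n) (Fin n) ℝ) (x : ℕ → ℝ)
    (Qs : ℕ → Matrix (Fin n) (Fin n) ℝ) {k : ℕ} (hk : k < r) :
    lagr β r L x Qs (k + 1) =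
      lagr β r L x Qs k + x k • (xiDeriv β (Qs (k + 1)) - xiDeriv β (Qs k)) := by
  rw [lagr, lagr, Finset.sum_eq_sum_Ico_succ_bot hk]
  abel

lemma dMat_last (r : ℕ) (x : ℕ → ℝ) (Qs : ℕ → Matrix (Fin n) (Fin n) ℝ) :
    dMat r x Qs r = 0 := by simp [dMat]

lemma dMat_succ {r : ℕ} (x : ℕ → ℝ) (Qs : ℕ → Matrix (Fin n) (Fin n) ℝ) {k : ℕ} (hk : k < r) :
    dMat r x Qs k = dMat r x Qs (k + 1) + x k • (Qs (k + 1) - Qs k) := by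
  rw [dMat, dMat, Finset.sum_eq_sum_Ico_succ_bot hk, add_comm]

lemma parisiLogTerm_of_pos {β : ℕ → Fin n → ℝ} {r : ℕ} {L : Matrix (Fin n) (Fin n) ℝ}
    {x : ℕ → ℝ} {Qs : ℕ → Matrix (Fin n) (Fin n) ℝ} {k : ℕ} (hx : 0 < x k)
    (h1 : (lagr β r L x Qs k).PosDef) (h2 : (lagr β r L x Qs (k + 1)).PosDef) :
    parisiLogTerm β r L x Qs k = 1 / x k *
      (Real.log (lagr β r L x Qs (k + 1)).det - Real.log (lagr β r L x Qs k).det) := by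
  rw [parisiLogTerm, if_neg hx.ne', Real.log_div h2.det_pos.ne' h1.det_pos.ne']

lemma csLogTerm_of_pos {r : ℕ} {x : ℕ → ℝ} {Qs : ℕ → Matrix (Fin n) (Fin n) ℝ} {k : ℕ}
    (hx : 0 < x k) (h1 : (dMat r x Qs k).PosDef) (h2 : (dMat r x Qs (k + 1)).PosDef) :
    csLogTerm r x Qs k = 1 / x k *
      (Real.log (dMat r x Qs (k + 1)).det - Real.log (dMat r x Qs k).det) := by
  rw [csLogTerm, if_neg hx.ne', Real.log_div h2.det_pos.ne' h1.det_pos.ne']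

/-! ### Summation by parts and the difference of the two functionals. -/

/-- Summation by parts for a pair of conjugate paths `L`, `D` driven by `U` and `Q`. -/
lemma sum_inn_conjugate_paths {r : ℕ} (hr : 1 ≤ r) {x : ℕ → ℝ}
    {U L D Q : ℕ → Matrix (Fin n) (Fin n) ℝ} (hx : ∀ k, 1 ≤ k → k < r → x k ≠ 0)
    (hL : ∀ k < r, L (k + 1) = L k + x k • (U (k + 1) - U k))
    (hD : ∀ k < r, D k = D (k + 1) + x k • (Q (k + 1) - Q k)) (hDr : D r = 0) :
    ∑ k ∈ Finset.Ico 1 r, 1 / x k * (inn (D (k + 1)) (L (k + 1)) - inn (D k) (L k)) -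
      ∑ k ∈ Finset.Ico 1 r, x k * (inn (Q (k + 1)) (U (k + 1)) - inn (Q k) (U k)) =
      inn (Q 1) (L 1) - inn (U 1) (D 1) - inn (L r) (Q r) := by
  have h : ∀ k ∈ Finset.Ico 1 r,
      1 / x k * (inn (D (k + 1)) (L (k + 1)) - inn (D k) (L k)) -
        x k * (inn (Q (k + 1)) (U (k + 1)) - inn (Q k) (U k)) =
      (inn (D (k + 1)) (U (k + 1)) - inn (Q (k + 1)) (L (k + 1))) -
        (inn (D k) (U k) - inn (Q k) (L k)) := by
    intro k hk
    rw [Finset.mem_Ico] at hk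
    have hxk := hx k hk.1 hk.2
    rw [hL k hk.2, hD k hk.2]
    simp only [inn_add_left, inn_add_right, inn_sub_left, inn_sub_right, inn_smul_left,
      inn_smul_right]
    field_simp
    ring
  rw [← Finset.sum_sub_distrib, Finset.sum_congr rfl h,
    Finset.sum_Ico_sub (fun k => inn (D k) (U k) - inn (Q k) (L k)) hr, hDr, inn_zero_left,
    inn_comm (U 1), inn_comm (L r)]
  ring

/-- Abel summation: the right side minus the left is `-∑_{1 ≤ k ≤ s} (x_k - x_{k-1}) F_k`. No sign
is needed for `F (s + 1)`. Used for Fenchel gaps and for `-Sum θ(Q_k)`. -/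
lemma le_sum_mul_sub_of_nonpos {x F : ℕ → ℝ} (hx0 : x 0 = 0) (s : ℕ)
    (hx : ∀ k < s, x k ≤ x (k + 1)) (hF : ∀ k, 1 ≤ k → k ≤ s → F k ≤ 0) :
    x s * F (s + 1) ≤ ∑ k ∈ Finset.Ico 1 (s + 1), x k * (F (k + 1) - F k) := by
  induction s with
  | zero => simp [hx0]
  | succ s ih =>
    rw [Finset.sum_Ico_succ_top (by omega)]
    have h1 := ih (fun k hk => hx k (by omega)) fun k h1 h2 => hF k h1 (by omega)
    have h2 := hx s (by omega)
    have h3 := hF (s + 1) (by omega) le_rfl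
    nlinarith

/-- The companion for decreasing weights, applied to `y_k = 1 / x_k` and the defects; the boundary
term at 1 vanishes. -/
lemma le_sum_mul_sub_of_nonneg {y b : ℕ → ℝ} (hb1 : b 1 = 0) (s : ℕ)
    (hy : ∀ k, 1 ≤ k → k < s → y (k + 1) ≤ y k) (hb : ∀ k, 1 ≤ k → k ≤ s → 0 ≤ b k) :
    y s * b (s + 1) ≤ ∑ k ∈ Finset.Ico 1 (s + 1), y k * (b (k + 1) - b k) := by
  induction s with
  | zero => simp [hb1]
  | succ s ih =>
    rw [Finset.sum_Ico_succ_top (by omega)]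
    have h1 := ih (fun k hk hk' => hy k hk (by omega)) fun k h1 h2 => hb k h1 (by omega)
    rcases Nat.eq_zero_or_pos s with rfl | hs
    · simp [hb1]
    · have h2 := hy s hs (by omega)
      have h3 := hb (s + 1) (by omega) le_rfl
      nlinarith

/-- The nonnegative defect in the duality inequality `log |D| + log |L| ≤ ⟨D, L⟩ - n`. -/
noncomputable def defect (D L : Matrix (Fin n) (Fin n) ℝ) : ℝ :=
  inn D L - n - Real.log D.det - Real.log L.det

lemma defect_nonneg {D L : Matrix (Fin n) (Fin n) ℝ} (hD : D.PosDef) (hL : L.PosDef) :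
    0 ≤ defect D L := by
  have := log_det_add_log_det_le hD hL
  rw [defect]
  linarith

lemma defect_inv {L : Matrix (Fin n) (Fin n) ℝ} (hL : L.PosDef) : defect L⁻¹ L = 0 := by
  rw [defect, inn_comm, inn_inv_self hL, log_det_inv]
  ring

lemma defect_inv' {D : Matrix (Fin n) (Fin n) ℝ} (hD : D.PosDef) : defect D D⁻¹ = 0 := by
  rw [defect, inn_inv_self hD, log_det_inv]
  ring

/-- The gap in the Fenchel–Young inequality between `A` and `B`, with a minus sign. -/
noncomputable def fenchelGap (β : ℕ → Fin n → ℝ) (A B : Matrix (Fin n) (Fin n) ℝ) : ℝ :=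
  inn B (xiDeriv β A) - entrySum (theta β A) - entrySum (xi β B)

/-- The difference of the two functionals, evaluated on two paths with the same `x` that are
conjugate at level one. -/
lemma two_mul_parisi_sub_crisantiSommers (β : ℕ → Fin n → ℝ) (h : Fin n → ℝ) (s : ℕ)
    (L : Matrix (Fin n) (Fin n) ℝ) (x : ℕ → ℝ) (Qs Qs' : ℕ → Matrix (Fin n) (Fin n) ℝ)
    (hx : ∀ k, 1 ≤ k → k < s + 2 → 0 < x k) (hx1 : x (s + 1) = 1)
    (hL : ∀ k, 1 ≤ k → k ≤ s + 2 → (lagr β (s + 2) L x Qs k).PosDef)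
    (hD : ∀ k, 1 ≤ k → k ≤ s + 1 → (dMat (s + 2) x Qs' k).PosDef)
    (hQ : Qs' (s + 2) = Qs (s + 2))
    (hLD : (lagr β (s + 2) L x Qs 1)⁻¹ = dMat (s + 2) x Qs' 1) :
    2 * parisi β h (s + 2) L x Qs - 2 * crisantiSommers β h (s + 2) x Qs' =
      ∑ k ∈ Finset.Ico 1 (s + 2),
        x k * (fenchelGap β (Qs (k + 1)) (Qs' (k + 1)) - fenchelGap β (Qs k) (Qs' k)) +
      defect (dMat (s + 2) x Qs' (s + 1)) (lagr β (s + 2) L x Qs (s + 1)) -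
      ∑ k ∈ Finset.Ico 1 (s + 1), 1 / x k *
        (defect (dMat (s + 2) x Qs' (k + 1)) (lagr β (s + 2) L x Qs (k + 1)) -
          defect (dMat (s + 2) x Qs' k) (lagr β (s + 2) L x Qs k)) := by
  have hLD' : (dMat (s + 2) x Qs' 1)⁻¹ = lagr β (s + 2) L x Qs 1 := by
    rw [← hLD, Matrix.nonsing_inv_nonsing_inv _
      ((Matrix.isUnit_iff_isUnit_det _).1 (hL 1 le_rfl (by omega)).isUnit)]
  have hDlast : Qs' (s + 2) - Qs' (s + 1) = dMat (s + 2) x Qs' (s + 1) := by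
    rw [dMat_succ x Qs' (by omega : s + 1 < s + 2), dMat_last, hx1, one_smul, zero_add]
  -- This supplies the trace parts of the defects and gaps, which neither functional contains. The
  -- step `k = s + 1` has weight 1 and `D_{s+2} = 0`, so it is split off and leaves the isolated
  -- defect at `s + 1`.
  have key := sum_inn_conjugate_paths (by omega : 1 ≤ s + 2)
    (fun k h1 h2 => (hx k h1 h2).ne') (fun k hk => lagr_succ β L x Qs hk)
    (fun k hk => dMat_succ x Qs' hk) (dMat_last (s + 2) x Qs') (U := fun k => xiDeriv β (Qs k))
  have hP : ∑ k ∈ Finset.Ico 1 (s + 2), parisiLogTerm β (s + 2) L x Qs k =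
      ∑ k ∈ Finset.Ico 1 (s + 2), 1 / x k * (Real.log (lagr β (s + 2) L x Qs (k + 1)).det -
        Real.log (lagr β (s + 2) L x Qs k).det) :=
    Finset.sum_congr rfl fun k hk => by
      rw [Finset.mem_Ico] at hk
      exact parisiLogTerm_of_pos (hx k hk.1 hk.2) (hL k hk.1 (by omega)) (hL _ (by omega) (by omega))
  have hC : ∑ k ∈ Finset.Ico 1 (s + 1), csLogTerm (s + 2) x Qs' k =
      ∑ k ∈ Finset.Ico 1 (s + 1), 1 / x k * (Real.log (dMat (s + 2) x Qs' (k + 1)).det -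
        Real.log (dMat (s + 2) x Qs' k).det) :=
    Finset.sum_congr rfl fun k hk => by
      rw [Finset.mem_Ico] at hk
      exact csLogTerm_of_pos (hx k hk.1 (by omega)) (hD k hk.1 (by omega))
        (hD _ (by omega) (by omega))
  rw [parisi, crisantiSommers, show s + 2 - 1 = s + 1 from rfl, hP, hC, hDlast, hx1, hLD, hLD']
  simp only [defect, fenchelGap, entrySum_sub, mul_sub, Finset.sum_sub_distrib] at key ⊢
  simp only [Finset.sum_Ico_succ_top (by omega : 1 ≤ s + 1), hx1, dMat_last, lagr_last,
    inn_zero_left, hQ] at key ⊢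
  linarith

/-! ### Positivity of `Λ_k` and `D_k`, and passage from 𝒞 to 𝒫. -/

lemma IsPath.lagr_posDef {β : ℕ → Fin n → ℝ}
    (hβ : ∀ j, Summable fun p : ℕ => (2 : ℝ) ^ p * β p j ^ 2)
    {Q : Matrix (Fin n) (Fin n) ℝ} (hQ : ∀ j, Q j j = 1) {r : ℕ} {x : ℕ → ℝ}
    {Qs : ℕ → Matrix (Fin n) (Fin n) ℝ} (hp : IsPath Q r x Qs) {L : Matrix (Fin n) (Fin n) ℝ}
    (hL : (lagr β r L x Qs 1).PosDef) {k : ℕ} (h1 : 1 ≤ k) (hk : k ≤ r) :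
    (lagr β r L x Qs k).PosDef := by
  induction k, h1 using Nat.le_induction with
  | base => exact hL
  | succ k _ ih =>
    rw [lagr_succ β L x Qs hk]
    exact (ih (by omega)).add_posSemidef
      ((hp.xiDeriv_sub_posSemidef hβ hQ hk).smul (hp.x_nonneg hk))

lemma IsPath.dMat_posDef {Q : Matrix (Fin n) (Fin n) ℝ} {r : ℕ} {x : ℕ → ℝ}
    {Qs : ℕ → Matrix (Fin n) (Fin n) ℝ} (hp : IsPath Q r x Qs) {k l : ℕ} (hkl : k ≤ l)
    (hl : l < r) (hD : 0 < (dMat r x Qs l).det) : (dMat r x Qs k).PosDef := by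
  induction hkl using Nat.decreasingInduction with
  | self =>
    refine Matrix.PosSemidef.posDef_iff_det_ne_zero ?_ |>.2 hD.ne'
    refine Matrix.posSemidef_sum _ fun k hk => ?_
    rw [Finset.mem_Ico] at hk
    exact (hp.Q_mono k hk.2).smul (hp.x_nonneg hk.2)
  | of_succ k hk ih =>
    rw [dMat_succ x Qs (by omega)]
    exact ih.add_posSemidef ((hp.Q_mono k (by omega)).smul (hp.x_nonneg (by omega)))

/-- `∑_{1 ≤ k ≤ r-1} x_k (ξ'(Q_{k+1}) - ξ'(Q_k))`, the difference between `Λ` and `Λ_1`. -/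
noncomputable def shift (β : ℕ → Fin n → ℝ) (r : ℕ) (x : ℕ → ℝ)
    (Qs : ℕ → Matrix (Fin n) (Fin n) ℝ) : Matrix (Fin n) (Fin n) ℝ :=
  ∑ k ∈ Finset.Ico 1 r, x k • (xiDeriv β (Qs (k + 1)) - xiDeriv β (Qs k))

lemma lagr_add_shift_one (β : ℕ → Fin n → ℝ) (r : ℕ) (M : Matrix (Fin n) (Fin n) ℝ) (x : ℕ → ℝ)
    (Qs : ℕ → Matrix (Fin n) (Fin n) ℝ) : lagr β r (M + shift β r x Qs) x Qs 1 = M := by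
  simp [lagr, shift]

lemma lagr_one_add_shift (β : ℕ → Fin n → ℝ) (r : ℕ) (L : Matrix (Fin n) (Fin n) ℝ) (x : ℕ → ℝ)
    (Qs : ℕ → Matrix (Fin n) (Fin n) ℝ) : lagr β r L x Qs 1 + shift β r x Qs = L := by
  simp [lagr, shift]

lemma IsPath.shift_posSemidef {β : ℕ → Fin n → ℝ}
    (hβ : ∀ j, Summable fun p : ℕ => (2 : ℝ) ^ p * β p j ^ 2)
    {Q : Matrix (Fin n) (Fin n) ℝ} (hQ : ∀ j, Q j j = 1) {r : ℕ} {x : ℕ → ℝ}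
    {Qs : ℕ → Matrix (Fin n) (Fin n) ℝ} (hp : IsPath Q r x Qs) :
    (shift β r x Qs).PosSemidef := by
  refine Matrix.posSemidef_sum _ fun k hk => ?_
  rw [Finset.mem_Ico] at hk
  exact (hp.xiDeriv_sub_posSemidef hβ hQ hk.2).smul (hp.x_nonneg hk.2)

/-- For every admissible Crisanti–Sommers datum with positive weights there is a Parisi datum with
a value that is no larger. -/
lemma IsPath.exists_parisi_le {β : ℕ → Fin n → ℝ}
    (hβ : ∀ j, Summable fun p : ℕ => (2 : ℝ) ^ p * β p j ^ 2) (h : Fin n → ℝ)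
    {Q : Matrix (Fin n) (Fin n) ℝ} (hQ : ∀ j, Q j j = 1) {s : ℕ} {x : ℕ → ℝ}
    {Qs : ℕ → Matrix (Fin n) (Fin n) ℝ} (hp : IsPath Q (s + 2) x Qs)
    (hx : ∀ k, 1 ≤ k → k < s + 2 → 0 < x k) (hx1 : x (s + 1) = 1)
    (hD : 0 < (dMat (s + 2) x Qs (s + 1)).det) :
    ∃ v ∈ parisiValues β h Q, v ≤ crisantiSommers β h (s + 2) x Qs := by
  have hDk : ∀ k, 1 ≤ k → k ≤ s + 1 → (dMat (s + 2) x Qs k).PosDef := fun k _ hk =>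
    hp.dMat_posDef hk (by omega) hD
  have hD1 := hDk 1 le_rfl (by omega)
  set L := (dMat (s + 2) x Qs 1)⁻¹ + shift β (s + 2) x Qs with hL
  have hL1 : lagr β (s + 2) L x Qs 1 = (dMat (s + 2) x Qs 1)⁻¹ := lagr_add_shift_one ..
  have hLpd : (lagr β (s + 2) L x Qs 1).PosDef := hL1 ▸ hD1.inv
  refine ⟨_, ⟨s + 2, L, x, Qs, hp, ?_, hLpd, rfl⟩, ?_⟩
  · exact hD1.inv.posSemidef.add (hp.shift_posSemidef hβ hQ)
  have key := two_mul_parisi_sub_crisantiSommers β h s L x Qs Qs hx hx1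
    (fun k h1 h2 => hp.lagr_posDef hβ hQ hLpd h1 h2) hDk rfl
    (by rw [hL1, Matrix.nonsing_inv_nonsing_inv _
      ((Matrix.isUnit_iff_isUnit_det _).1 hD1.isUnit)])
  have hF : ∀ k ≤ s + 2, fenchelGap β (Qs k) (Qs k) = 0 := fun k hk => by
    rw [fenchelGap, inn_xiDeriv_self hβ (hp.isSymm hk) (hp.abs_apply_le_one hQ hk)]
    ring
  rw [Finset.sum_eq_zero (s := Finset.Ico 1 (s + 2)) (fun k hk => by
    rw [Finset.mem_Ico] at hk
    rw [hF k (by omega), hF (k + 1) (by omega), sub_zero, mul_zero])] at key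
  have hb1 : defect (dMat (s + 2) x Qs 1) (lagr β (s + 2) L x Qs 1) = 0 := by
    rw [hL1, defect_inv' hD1]
  have hb : ∀ k, 1 ≤ k → k ≤ s + 1 →
      0 ≤ defect (dMat (s + 2) x Qs k) (lagr β (s + 2) L x Qs k) := fun k h1 h2 =>
    defect_nonneg (hDk k h1 h2) (hp.lagr_posDef hβ hQ hLpd h1 (by omega))
  have habel := le_sum_mul_sub_of_nonneg (y := fun k => 1 / x k)
    (b := fun k => defect (dMat (s + 2) x Qs k) (lagr β (s + 2) L x Qs k)) hb1 s
    (fun k h1 h2 => one_div_le_one_div_of_le (hx k h1 (by omega)) (hp.x_mono k (by omega)))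
    (fun k h1 h2 => hb k h1 (by omega))
  -- The isolated defect is absorbed because `x s ≤ 1`. For `s = 0` the weight is 0 and `1 / x 0` is
  -- the default 0, but the defect is then the vanishing one at level 1.
  have hfin : defect (dMat (s + 2) x Qs (s + 1)) (lagr β (s + 2) L x Qs (s + 1)) ≤
      1 / x s * defect (dMat (s + 2) x Qs (s + 1)) (lagr β (s + 2) L x Qs (s + 1)) := by
    rcases Nat.eq_zero_or_pos s with rfl | hs
    · simp [hb1]
    · exact le_mul_of_one_le_left (hb _ (by omega) le_rfl)
        ((one_le_div (hx s hs (by omega))).2 (hp.x_le (by omega)))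
  linarith

/-! ### The Parisi functional as a function of `Λ_1`: coercivity and optimality. -/

/-- Twice the Parisi functional as a function of `M = Λ_1`, for positive weights. -/
noncomputable def parisiLagrOne (β : ℕ → Fin n → ℝ) (h : Fin n → ℝ) (r : ℕ) (x : ℕ → ℝ)
    (Qs : ℕ → Matrix (Fin n) (Fin n) ℝ) (M : Matrix (Fin n) (Fin n) ℝ) : ℝ :=
  inn (Matrix.vecMulVec h h) M⁻¹ + inn (M + shift β r x Qs) (Qs r) - n
    - Real.log (M + shift β r x Qs).det
    + ∑ k ∈ Finset.Ico 1 r, 1 / x k *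
      (Real.log (M + lagr β r (shift β r x Qs) x Qs (k + 1)).det -
        Real.log (M + lagr β r (shift β r x Qs) x Qs k).det)
    + inn (xiDeriv β (Qs 1)) M⁻¹
    - ∑ k ∈ Finset.Ico 1 r, x k * entrySum (theta β (Qs (k + 1)) - theta β (Qs k))

lemma add_lagr_shift (β : ℕ → Fin n → ℝ) (r : ℕ) (x : ℕ → ℝ)
    (Qs : ℕ → Matrix (Fin n) (Fin n) ℝ) (M : Matrix (Fin n) (Fin n) ℝ) (k : ℕ) :
    M + lagr β r (shift β r x Qs) x Qs k = lagr β r (M + shift β r x Qs) x Qs k := by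
  simp [lagr, add_sub_assoc]

lemma IsPath.add_lagr_shift_posDef {β : ℕ → Fin n → ℝ}
    (hβ : ∀ j, Summable fun p : ℕ => (2 : ℝ) ^ p * β p j ^ 2)
    {Q : Matrix (Fin n) (Fin n) ℝ} (hQ : ∀ j, Q j j = 1) {r : ℕ} {x : ℕ → ℝ}
    {Qs : ℕ → Matrix (Fin n) (Fin n) ℝ} (hp : IsPath Q r x Qs) {M : Matrix (Fin n) (Fin n) ℝ}
    (hM : M.PosDef) {k : ℕ} (h1 : 1 ≤ k) (hk : k ≤ r) :
    (M + lagr β r (shift β r x Qs) x Qs k).PosDef := by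
  rw [add_lagr_shift]
  exact hp.lagr_posDef hβ hQ ((lagr_add_shift_one β r M x Qs).symm ▸ hM) h1 hk

lemma IsPath.two_mul_parisi {β : ℕ → Fin n → ℝ}
    (hβ : ∀ j, Summable fun p : ℕ => (2 : ℝ) ^ p * β p j ^ 2) (h : Fin n → ℝ)
    {Q : Matrix (Fin n) (Fin n) ℝ} (hQ : ∀ j, Q j j = 1) {r : ℕ} {x : ℕ → ℝ}
    {Qs : ℕ → Matrix (Fin n) (Fin n) ℝ} (hp : IsPath Q r x Qs)
    (hx : ∀ k, 1 ≤ k → k < r → 0 < x k) {M : Matrix (Fin n) (Fin n) ℝ} (hM : M.PosDef) :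
    2 * parisi β h r (M + shift β r x Qs) x Qs = parisiLagrOne β h r x Qs M := by
  have hpd := fun k h1 h2 => hp.add_lagr_shift_posDef hβ hQ hM (k := k) h1 h2
  rw [parisi, parisiLagrOne, lagr_add_shift_one]
  simp only [add_lagr_shift] at hpd ⊢
  rw [Finset.sum_congr rfl fun k hk => parisiLogTerm_of_pos
    (hx k (Finset.mem_Ico.1 hk).1 (Finset.mem_Ico.1 hk).2)
    (hpd k (Finset.mem_Ico.1 hk).1 (Finset.mem_Ico.1 hk).2.le)
    (hpd (k + 1) (by omega) (Finset.mem_Ico.1 hk).2)]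
  ring

lemma continuousOn_log_det_add {S : Set (Matrix (Fin n) (Fin n) ℝ)}
    {W : Matrix (Fin n) (Fin n) ℝ} (hW : ∀ M ∈ S, (M + W).PosDef) :
    ContinuousOn (fun M => Real.log (M + W).det) S :=
  ContinuousOn.log (by fun_prop) fun M hM => (hW M hM).det_pos.ne'

lemma continuousOn_inn_inv (W : Matrix (Fin n) (Fin n) ℝ) :
    ContinuousOn (fun M => inn W M⁻¹) {M | M.PosDef} := by
  have h1 : Continuous fun M : Matrix (Fin n) (Fin n) ℝ => inn W M := by
    unfold inn
    fun_prop
  exact h1.comp_continuousOn (continuousOn_inv.mono fun M hM => hM.det_pos.ne')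

lemma IsPath.continuousOn_parisiLagrOne {β : ℕ → Fin n → ℝ}
    (hβ : ∀ j, Summable fun p : ℕ => (2 : ℝ) ^ p * β p j ^ 2) (h : Fin n → ℝ)
    {Q : Matrix (Fin n) (Fin n) ℝ} (hQ : ∀ j, Q j j = 1) {r : ℕ} {x : ℕ → ℝ}
    {Qs : ℕ → Matrix (Fin n) (Fin n) ℝ} (hp : IsPath Q r x Qs) :
    ContinuousOn (parisiLagrOne β h r x Qs) {M | M.PosDef} := by
  have h1 : Continuous fun M : Matrix (Fin n) (Fin n) ℝ => inn (M + shift β r x Qs) (Qs r) := by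
    unfold inn
    fun_prop
  refine (((((continuousOn_inn_inv _).add h1.continuousOn).sub continuousOn_const).sub
    (continuousOn_log_det_add fun M hM => hM.add_posSemidef (hp.shift_posSemidef hβ hQ))).add
    ?_).add (continuousOn_inn_inv _) |>.sub continuousOn_const
  refine continuousOn_finsetSum _ fun k hk => ?_
  rw [Finset.mem_Ico] at hk
  exact continuousOn_const.mul
    ((continuousOn_log_det_add fun M hM => hp.add_lagr_shift_posDef hβ hQ hM (by omega) hk.2).sub
    (continuousOn_log_det_add fun M hM => hp.add_lagr_shift_posDef hβ hQ hM hk.1 hk.2.le))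

/-- The increments of `log|Λ_k|` are nonnegative and `1 / x_k ≥ 1`, so the log sum is at least the
telescoping `log|Λ| - log|Λ_1|`, which trades `-log|Λ|` for `-log|M|`. This gives both the
coercivity in `M` and the lower bound on 𝒫. -/
lemma IsPath.le_parisiLagrOne {β : ℕ → Fin n → ℝ}
    (hβ : ∀ j, Summable fun p : ℕ => (2 : ℝ) ^ p * β p j ^ 2) (h : Fin n → ℝ)
    {Q : Matrix (Fin n) (Fin n) ℝ} (hQ : ∀ j, Q j j = 1) {r : ℕ} {x : ℕ → ℝ}
    {Qs : ℕ → Matrix (Fin n) (Fin n) ℝ} (hp : IsPath Q r x Qs)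
    (hx : ∀ k, 1 ≤ k → k < r → 0 < x k) {M : Matrix (Fin n) (Fin n) ℝ} (hM : M.PosDef) :
    inn M Q - Real.log M.det - n -
      ∑ k ∈ Finset.Ico 1 r, x k * entrySum (theta β (Qs (k + 1)) - theta β (Qs k)) ≤
      parisiLagrOne β h r x Qs M := by
  have hpd := fun k h1 h2 => hp.add_lagr_shift_posDef hβ hQ hM (k := k) h1 h2
  have h1 : ∑ k ∈ Finset.Ico 1 r, (Real.log (M + lagr β r (shift β r x Qs) x Qs (k + 1)).det -
        Real.log (M + lagr β r (shift β r x Qs) x Qs k).det) ≤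
      ∑ k ∈ Finset.Ico 1 r, 1 / x k *
        (Real.log (M + lagr β r (shift β r x Qs) x Qs (k + 1)).det -
          Real.log (M + lagr β r (shift β r x Qs) x Qs k).det) := by
    refine Finset.sum_le_sum fun k hk => ?_
    rw [Finset.mem_Ico] at hk
    refine le_mul_of_one_le_left (sub_nonneg.2 (log_det_mono (hpd k hk.1 hk.2.le) ?_))
      ((one_le_div (hx k hk.1 hk.2)).2 (hp.x_le hk.2))
    rw [lagr_succ _ _ _ _ hk.2, ← add_assoc, add_sub_cancel_left]
    exact (hp.xiDeriv_sub_posSemidef hβ hQ hk.2).smul (hp.x_nonneg hk.2)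
  rw [Finset.sum_Ico_sub (fun k => Real.log (M + lagr β r (shift β r x Qs) x Qs k).det)
    hp.one_le, lagr_last, add_lagr_shift, lagr_add_shift_one] at h1
  have h2 : 0 ≤ inn (Matrix.vecMulVec h h) M⁻¹ :=
    inn_nonneg (Matrix.posSemidef_vecMulVec_self_star h) hM.inv.posSemidef
  have h3 : 0 ≤ inn (xiDeriv β (Qs 1)) M⁻¹ := by
    refine inn_nonneg ?_ hM.inv.posSemidef
    simpa [hp.Q_zero, xiDeriv_zero] using hp.xiDeriv_sub_posSemidef hβ hQ hp.one_le
  have h4 : 0 ≤ inn (shift β r x Qs) Q :=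
    inn_nonneg (hp.shift_posSemidef hβ hQ) (hp.Q_last ▸ hp.posSemidef le_rfl)
  rw [parisiLagrOne, hp.Q_last, inn_add_left]
  linarith

lemma nonneg_of_hasDerivAt_of_le {f : ℝ → ℝ} {f' : ℝ} (hf : HasDerivAt f f' 0)
    (hmin : ∀ t, 0 ≤ t → f 0 ≤ f t) : 0 ≤ f' := by
  have h1 := (hasDerivWithinAt_iff_tendsto_slope' (s := Set.Ioi (0 : ℝ)) (by simp)).1
    hf.hasDerivWithinAt
  refine ge_of_tendsto h1 (eventually_nhdsWithin_of_forall fun t ht => ?_)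
  rw [slope_def_field]
  exact div_nonneg (sub_nonneg.2 (hmin t (le_of_lt ht))) (by simpa using le_of_lt ht)

/-- The first order condition for a minimizer of the Parisi functional in `Λ_1`. -/
lemma IsPath.first_order_condition {β : ℕ → Fin n → ℝ}
    (hβ : ∀ j, Summable fun p : ℕ => (2 : ℝ) ^ p * β p j ^ 2) (h : Fin n → ℝ)
    {Q : Matrix (Fin n) (Fin n) ℝ} (hQ : ∀ j, Q j j = 1) {r : ℕ} {x : ℕ → ℝ}
    {Qs : ℕ → Matrix (Fin n) (Fin n) ℝ} (hp : IsPath Q r x Qs)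
    {M : Matrix (Fin n) (Fin n) ℝ} (hM : M.PosDef)
    (hmin : ∀ M', M'.PosDef → parisiLagrOne β h r x Qs M ≤ parisiLagrOne β h r x Qs M')
    (v : Fin n → ℝ) :
    0 ≤ inn Q (Matrix.vecMulVec v v) - inn (M + shift β r x Qs)⁻¹ (Matrix.vecMulVec v v) +
      ∑ k ∈ Finset.Ico 1 r, 1 / x k *
        (inn (M + lagr β r (shift β r x Qs) x Qs (k + 1))⁻¹ (Matrix.vecMulVec v v) -
          inn (M + lagr β r (shift β r x Qs) x Qs k)⁻¹ (Matrix.vecMulVec v v)) := by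
  have hpd := fun k h1 h2 => hp.add_lagr_shift_posDef hβ hQ hM (k := k) h1 h2
  have hlog : ∀ W : Matrix (Fin n) (Fin n) ℝ, (M + W).PosDef →
      HasDerivAt (fun t : ℝ => Real.log (M + t • Matrix.vecMulVec v v + W).det)
        (inn (M + W)⁻¹ (Matrix.vecMulVec v v)) 0 := by
    intro W hW
    simp_rw [add_right_comm M _ W]
    rw [inn_vecMulVec]
    exact hasDerivAt_log_det hW v
  have hlin : HasDerivAt (fun t : ℝ => inn (M + t • Matrix.vecMulVec v v + shift β r x Qs) (Qs r))
      (inn Q (Matrix.vecMulVec v v)) 0 := by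
    simp_rw [inn_add_left, inn_smul_left]
    rw [hp.Q_last, inn_comm Q]
    simpa using (((hasDerivAt_id (0 : ℝ)).mul_const (inn (Matrix.vecMulVec v v) Q)).const_add
      (inn M Q)).add_const (inn (shift β r x Qs) Q)
  have hsum := HasDerivAt.fun_sum (u := Finset.Ico 1 r) fun k hk =>
    (((hlog _ (hpd (k + 1) (by omega) (Finset.mem_Ico.1 hk).2)).sub
      (hlog _ (hpd k (Finset.mem_Ico.1 hk).1 (Finset.mem_Ico.1 hk).2.le))).const_mul (1 / x k))
  have hder := ((((((hasDerivAt_inn_inv hM v (Matrix.vecMulVec h h)).add hlin).sub_const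
    (n : ℝ)).sub (hlog _ (hM.add_posSemidef (hp.shift_posSemidef hβ hQ)))).add hsum).add
    (hasDerivAt_inn_inv hM v (xiDeriv β (Qs 1)))).sub_const
    (∑ k ∈ Finset.Ico 1 r, x k * entrySum (theta β (Qs (k + 1)) - theta β (Qs k)))
  have h1 := nonneg_of_hasDerivAt_of_le
    (f := fun t : ℝ => parisiLagrOne β h r x Qs (M + t • Matrix.vecMulVec v v)) hder
    fun t ht => by
      simp only [zero_smul, add_zero]
      exact hmin _ (hM.add_posSemidef
        ((Matrix.posSemidef_vecMulVec_self_star v).smul ht))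
  -- The terms in `M⁻¹` have nonpositive derivative, so dropping them from the optimality condition
  -- preserves the inequality.
  have h2 : 0 ≤ (M⁻¹ *ᵥ v) ⬝ᵥ (Matrix.vecMulVec h h *ᵥ (M⁻¹ *ᵥ v)) :=
    (Matrix.posSemidef_vecMulVec_self_star h).dotProduct_mulVec_nonneg _
  have h3 : 0 ≤ (M⁻¹ *ᵥ v) ⬝ᵥ (xiDeriv β (Qs 1) *ᵥ (M⁻¹ *ᵥ v)) := by
    refine Matrix.PosSemidef.dotProduct_mulVec_nonneg ?_ _
    simpa [hp.Q_zero, xiDeriv_zero] using hp.xiDeriv_sub_posSemidef hβ hQ hp.one_le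
  linarith

/-! ### The conjugate path, and passage from 𝒫 to 𝒞. -/

/-- The path whose matrices `D_k` are the given matrices `Y_k`. -/
noncomputable def conjugatePath (Q : Matrix (Fin n) (Fin n) ℝ) (s : ℕ) (x : ℕ → ℝ)
    (Y : ℕ → Matrix (Fin n) (Fin n) ℝ) (k : ℕ) : Matrix (Fin n) (Fin n) ℝ :=
  if k = 0 then 0
  else if k ≤ s + 1 then Q - Y (s + 1) - ∑ l ∈ Finset.Ico k (s + 1), (1 / x l) • (Y l - Y (l + 1))
  else Q

lemma conjugatePath_succ_sub (Q : Matrix (Fin n) (Fin n) ℝ) (s : ℕ) (x : ℕ → ℝ)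
    (Y : ℕ → Matrix (Fin n) (Fin n) ℝ) {k : ℕ} (h1 : 1 ≤ k) (hk : k ≤ s) :
    conjugatePath Q s x Y (k + 1) - conjugatePath Q s x Y k = (1 / x k) • (Y k - Y (k + 1)) := by
  rw [conjugatePath, conjugatePath, if_neg (by omega), if_pos (by omega), if_neg (by omega),
    if_pos (by omega), Finset.sum_eq_sum_Ico_succ_bot (by omega : k < s + 1)]
  abel

lemma conjugatePath_last (Q : Matrix (Fin n) (Fin n) ℝ) (s : ℕ) (x : ℕ → ℝ)
    (Y : ℕ → Matrix (Fin n) (Fin n) ℝ) : conjugatePath Q s x Y (s + 2) = Q := by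
  simp [conjugatePath]

lemma conjugatePath_last_sub (Q : Matrix (Fin n) (Fin n) ℝ) (s : ℕ) (x : ℕ → ℝ)
    (Y : ℕ → Matrix (Fin n) (Fin n) ℝ) :
    conjugatePath Q s x Y (s + 2) - conjugatePath Q s x Y (s + 1) = Y (s + 1) := by
  simp [conjugatePath]

lemma dMat_conjugatePath (Q : Matrix (Fin n) (Fin n) ℝ) {s : ℕ} {x : ℕ → ℝ}
    (Y : ℕ → Matrix (Fin n) (Fin n) ℝ) (hx : ∀ k, 1 ≤ k → k < s + 2 → 0 < x k)
    (hx1 : x (s + 1) = 1) {k : ℕ} (h1 : 1 ≤ k) (hk : k ≤ s + 1) :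
    dMat (s + 2) x (conjugatePath Q s x Y) k = Y k := by
  induction hk using Nat.decreasingInduction with
  | self =>
    rw [dMat_succ x _ (by omega : s + 1 < s + 2), dMat_last, conjugatePath_last_sub, hx1, one_smul,
      zero_add]
  | of_succ k hk ih =>
    rw [dMat_succ x _ (by omega), ih (by omega), conjugatePath_succ_sub Q s x Y h1 (by omega),
      smul_smul, mul_one_div_cancel (hx k h1 (by omega)).ne', one_smul, add_sub_cancel]

lemma inn_sum_left {ι : Type*} (S : Finset ι) (f : ι → Matrix (Fin n) (Fin n) ℝ)
    (B : Matrix (Fin n) (Fin n) ℝ) : inn (∑ i ∈ S, f i) B = ∑ i ∈ S, inn (f i) B := by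
  simp [inn, Finset.sum_mul, Matrix.trace_sum]

lemma posSemidef_of_inn_vecMulVec_nonneg {A : Matrix (Fin n) (Fin n) ℝ} (hA : A.IsHermitian)
    (h : ∀ v, 0 ≤ inn A (Matrix.vecMulVec v v)) : A.PosSemidef :=
  Matrix.PosSemidef.of_dotProduct_mulVec_nonneg hA fun v => by
    simpa [inn_vecMulVec] using h v

/-- For every admissible Parisi datum with positive weights there is a Crisanti–Sommers datum with
a value that is no larger. -/
lemma IsPath.exists_crisantiSommers_le {β : ℕ → Fin n → ℝ}
    (hβ : ∀ j, Summable fun p : ℕ => (2 : ℝ) ^ p * β p j ^ 2)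
    (hβ_odd : ∀ p, 2 ≤ p → Odd p → β p = 0)
    (hβ_sign : ∀ p, 2 ≤ p → ∀ i j, 0 ≤ β p i * β p j) (h : Fin n → ℝ)
    {Q : Matrix (Fin n) (Fin n) ℝ} (hQpd : Q.PosDef) (hQ : ∀ j, Q j j = 1) {s : ℕ} {x : ℕ → ℝ}
    {Qs : ℕ → Matrix (Fin n) (Fin n) ℝ} (hp : IsPath Q (s + 2) x Qs)
    (hx : ∀ k, 1 ≤ k → k < s + 2 → 0 < x k) (hx1 : x (s + 1) = 1)
    {L : Matrix (Fin n) (Fin n) ℝ} (hL : (lagr β (s + 2) L x Qs 1).PosDef) :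
    ∃ v ∈ csValues β h Q, v ≤ parisi β h (s + 2) L x Qs := by
  obtain ⟨M, hM, hmin⟩ := exists_min_of_coercive hQpd (parisiLagrOne β h (s + 2) x Qs)
    (hp.continuousOn_parisiLagrOne hβ h hQ)
    (-n - ∑ k ∈ Finset.Ico 1 (s + 2), x k * entrySum (theta β (Qs (k + 1)) - theta β (Qs k)))
    (fun M hM => by linarith [hp.le_parisiLagrOne hβ h hQ hx hM])
  have hLM : 2 * parisi β h (s + 2) (M + shift β (s + 2) x Qs) x Qs ≤
      2 * parisi β h (s + 2) L x Qs := by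
    rw [hp.two_mul_parisi hβ h hQ hx hM]
    conv_rhs => rw [← lagr_one_add_shift β (s + 2) L x Qs]
    rw [hp.two_mul_parisi hβ h hQ hx hL]
    exact hmin _ hL
  have hfoc := hp.first_order_condition hβ h hQ hM hmin
  simp only [add_lagr_shift] at hfoc
  have hM1 : lagr β (s + 2) (M + shift β (s + 2) x Qs) x Qs 1 = M := lagr_add_shift_one ..
  have hN : ∀ k, 1 ≤ k → k ≤ s + 2 →
      (lagr β (s + 2) (M + shift β (s + 2) x Qs) x Qs k).PosDef := fun k h1 h2 =>
    hp.lagr_posDef hβ hQ (hM1.symm ▸ hM) h1 h2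
  set N := lagr β (s + 2) (M + shift β (s + 2) x Qs) x Qs with hNdef
  set Qs' := conjugatePath Q s x (fun k => (N k)⁻¹) with hQs'
  have hanti : ∀ k, 1 ≤ k → k ≤ s → ((N k)⁻¹ - (N (k + 1))⁻¹).PosSemidef := fun k h1 h2 => by
    refine inv_antitone (hN k h1 (by omega)) ?_
    rw [hNdef, lagr_succ _ _ _ _ (by omega), add_sub_cancel_left]
    exact (hp.xiDeriv_sub_posSemidef hβ hQ (by omega)).smul (hx k h1 (by omega)).le
  -- The only nontrivial condition on the new path. As the last weight is 1, the `k = s + 1` term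
  -- cancels `Λ⁻¹` in the optimality condition, whose right side becomes `⟨Q'_1, v vᵀ⟩`.
  have hfirst : (Qs' 1).PosSemidef := by
    have hQ1 : Qs' 1 = Q - (N (s + 1))⁻¹ -
        ∑ l ∈ Finset.Ico 1 (s + 1), (1 / x l) • ((N l)⁻¹ - (N (l + 1))⁻¹) := by
      simp [hQs', conjugatePath]
    rw [hQ1]
    refine posSemidef_of_inn_vecMulVec_nonneg ?_ fun v => ?_
    · refine (hQpd.1.sub (hN (s + 1) (by omega) (by omega)).inv.1).sub ?_
      refine (Matrix.posSemidef_sum _ fun l hl => ?_).1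
      rw [Finset.mem_Ico] at hl
      exact (hanti l hl.1 (by omega)).smul (one_div_nonneg.2 (hx l hl.1 (by omega)).le)
    · have h1 := hfoc v
      rw [Finset.sum_Ico_succ_top (by omega), hx1, show M + shift β (s + 2) x Qs = N (s + 2) from
        (lagr_last ..).symm] at h1
      rw [inn_sub_left, inn_sub_left, inn_sum_left]
      simp only [inn_smul_left, inn_sub_left]
      have h2 : ∀ k, 1 / x k * (inn (N (k + 1))⁻¹ (Matrix.vecMulVec v v) -
          inn (N k)⁻¹ (Matrix.vecMulVec v v)) = -(1 / x k * (inn (N k)⁻¹ (Matrix.vecMulVec v v) -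
          inn (N (k + 1))⁻¹ (Matrix.vecMulVec v v))) := fun k => by ring
      simp only [h2, Finset.sum_neg_distrib] at h1
      linarith
  have hp' : IsPath Q (s + 2) x Qs' :=
    { one_le := by omega
      x_zero := hp.x_zero
      x_mono := hp.x_mono
      x_le_one := hp.x_le_one
      Q_zero := by simp [hQs', conjugatePath]
      Q_last := conjugatePath_last ..
      Q_mono := fun k hk => by
        rcases Nat.eq_zero_or_pos k with rfl | hk0
        · simpa [hQs', conjugatePath] using hfirst
        · rcases Nat.lt_succ_iff_lt_or_eq.1 hk with hk | rfl
          · rw [hQs', conjugatePath_succ_sub Q s x _ hk0 (by omega)]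
            exact (hanti k hk0 (by omega)).smul (one_div_nonneg.2 (hx k hk0 (by omega)).le)
          · rw [hQs', conjugatePath_last_sub]
            exact (hN _ (by omega) (by omega)).inv.posSemidef }
  have hD : ∀ k, 1 ≤ k → k ≤ s + 1 → dMat (s + 2) x Qs' k = (N k)⁻¹ := fun k h1 h2 =>
    dMat_conjugatePath Q _ hx hx1 h1 h2
  have hDpd : ∀ k, 1 ≤ k → k ≤ s + 1 → (dMat (s + 2) x Qs' k).PosDef := fun k h1 h2 => by
    rw [hD k h1 h2]
    exact (hN k h1 (by omega)).inv
  refine ⟨_, ⟨s + 2, x, Qs', hp', hx1, (hDpd (s + 1) (by omega) le_rfl).det_pos, rfl⟩, ?_⟩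
  have key := two_mul_parisi_sub_crisantiSommers β h s (M + shift β (s + 2) x Qs) x Qs Qs' hx hx1
    hN hDpd (hp'.Q_last.trans hp.Q_last.symm) (hD 1 le_rfl (by omega)).symm
  rw [← hNdef] at key
  have hdef : ∀ k, 1 ≤ k → k ≤ s + 1 → defect (dMat (s + 2) x Qs' k) (N k) = 0 := fun k h1 h2 => by
    rw [hD k h1 h2, defect_inv (hN k h1 (by omega))]
  rw [hdef (s + 1) (by omega) le_rfl, Finset.sum_eq_zero (s := Finset.Ico 1 (s + 1)) (fun k hk => by
    rw [Finset.mem_Ico] at hk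
    rw [hdef k hk.1 (by omega), hdef (k + 1) (by omega) (by omega), sub_zero, mul_zero])] at key
  have hF : ∀ k ≤ s + 2, fenchelGap β (Qs k) (Qs' k) ≤ 0 := fun k hk => by
    have := inn_xiDeriv_le hβ hβ_odd hβ_sign (hp.isSymm hk) (hp.abs_apply_le_one hQ hk)
      (hp'.abs_apply_le_one hQ hk)
    rw [fenchelGap]
    linarith
  have hFlast : fenchelGap β (Qs (s + 2)) (Qs' (s + 2)) = 0 := by
    rw [hp'.Q_last, ← hp.Q_last, fenchelGap,
      inn_xiDeriv_self hβ (hp.isSymm le_rfl) (hp.abs_apply_le_one hQ le_rfl)]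
    ring
  have habel := le_sum_mul_sub_of_nonpos (F := fun k => fenchelGap β (Qs k) (Qs' k)) hp.x_zero
    (s + 1) (fun k hk => hp.x_mono k (by omega)) (fun k _ hk => hF k (by omega))
  rw [hFlast, mul_zero] at habel
  linarith

/-! ### A lower bound for 𝒫 depending on neither the path nor `Λ`. -/

lemma IsPath.log_det_sub_theta_le {β : ℕ → Fin n → ℝ}
    (hβ : ∀ j, Summable fun p : ℕ => (2 : ℝ) ^ p * β p j ^ 2)
    (hβ_odd : ∀ p, 2 ≤ p → Odd p → β p = 0)
    (hβ_sign : ∀ p, 2 ≤ p → ∀ i j, 0 ≤ β p i * β p j) (h : Fin n → ℝ)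
    {Q : Matrix (Fin n) (Fin n) ℝ} (hQpd : Q.PosDef) (hQ : ∀ j, Q j j = 1) {s : ℕ} {x : ℕ → ℝ}
    {Qs : ℕ → Matrix (Fin n) (Fin n) ℝ} (hp : IsPath Q (s + 2) x Qs)
    (hx : ∀ k, 1 ≤ k → k < s + 2 → 0 < x k)
    {L : Matrix (Fin n) (Fin n) ℝ} (hL : (lagr β (s + 2) L x Qs 1).PosDef) :
    Real.log Q.det - entrySum (theta β Q) ≤ 2 * parisi β h (s + 2) L x Qs := by
  rw [← lagr_one_add_shift β (s + 2) L x Qs, hp.two_mul_parisi hβ h hQ hx hL]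
  refine le_trans ?_ (hp.le_parisiLagrOne hβ h hQ hx hL)
  have h1 := log_det_add_log_det_le hL hQpd
  have h2 := le_sum_mul_sub_of_nonpos (F := fun k => -entrySum (theta β (Qs k))) hp.x_zero
    (s + 1) (fun k hk => hp.x_mono k (by omega))
    (fun k _ _ => neg_nonpos.2 (entrySum_theta_nonneg hβ_odd hβ_sign _))
  have h3 : ∑ k ∈ Finset.Ico 1 (s + 1 + 1),
      x k * (-entrySum (theta β (Qs (k + 1))) - -entrySum (theta β (Qs k))) =
      -∑ k ∈ Finset.Ico 1 (s + 2), x k * entrySum (theta β (Qs (k + 1)) - theta β (Qs k)) := by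
    rw [← Finset.sum_neg_distrib]
    exact Finset.sum_congr rfl fun k _ => by rw [entrySum_sub]; ring
  have h4 := entrySum_theta_nonneg hβ_odd hβ_sign Q
  have h5 := hp.x_le (by omega : s + 1 < s + 2)
  rw [h3, show Qs (s + 1 + 1) = Q from hp.Q_last] at h2
  nlinarith

/-! ### Reduction to positive weights with last weight 1. -/

/-- Dropping a first step of zero weight changes neither functional. -/
lemma IsPath.drop_zero_step {Q : Matrix (Fin n) (Fin n) ℝ} {s : ℕ} {x : ℕ → ℝ}
    {Qs : ℕ → Matrix (Fin n) (Fin n) ℝ} (hp : IsPath Q (s + 3) x Qs) (hx1 : x 1 = 0) :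
    ∃ (x' : ℕ → ℝ) (Qs' : ℕ → Matrix (Fin n) (Fin n) ℝ), IsPath Q (s + 2) x' Qs' ∧
      x' (s + 1) = x (s + 2) ∧ dMat (s + 2) x' Qs' (s + 1) = dMat (s + 3) x Qs (s + 2) ∧
      (∀ β L, lagr β (s + 2) L x' Qs' 1 = lagr β (s + 3) L x Qs 1) ∧
      (∀ β h L, parisi β h (s + 2) L x' Qs' = parisi β h (s + 3) L x Qs) ∧
      ∀ β h, crisantiSommers β h (s + 2) x' Qs' = crisantiSommers β h (s + 3) x Qs := by
  set x' : ℕ → ℝ := fun k => x (k + 1) with hx'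
  set Qs' : ℕ → Matrix (Fin n) (Fin n) ℝ := fun k => if k = 0 then 0 else Qs (k + 1) with hQs'
  have hQk : ∀ k, 1 ≤ k → Qs' k = Qs (k + 1) := fun k hk => if_neg (by omega)
  have hshift : ∀ {E : Type} [AddCommMonoid E] (f g : ℕ → E) (p q : ℕ), 1 ≤ p →
      (∀ k, 1 ≤ k → f k = g (k + 1)) →
      ∑ k ∈ Finset.Ico p q, f k = ∑ k ∈ Finset.Ico (p + 1) (q + 1), g k := by
    intro E _ f g p q hpq hfg
    rw [← Finset.sum_Ico_add']
    exact Finset.sum_congr rfl fun k hk => hfg k (hpq.trans (Finset.mem_Ico.1 hk).1)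
  have hD : ∀ p, 1 ≤ p → dMat (s + 2) x' Qs' p = dMat (s + 3) x Qs (p + 1) := fun p h1 =>
    hshift _ _ _ _ h1 fun k hk => by rw [hQk k hk, hQk (k + 1) (by omega)]
  have hlag : ∀ β L p, 1 ≤ p → lagr β (s + 2) L x' Qs' p = lagr β (s + 3) L x Qs (p + 1) :=
    fun β L p h1 => congrArg (L - ·)
      (hshift _ _ _ _ h1 fun k hk => by rw [hQk k hk, hQk (k + 1) (by omega)])
  have hlag1 : ∀ β L, lagr β (s + 3) L x Qs 2 = lagr β (s + 3) L x Qs 1 := fun β L => by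
    rw [lagr_succ β L x Qs (by omega : 1 < s + 3), hx1, zero_smul, add_zero]
  have hD1 : dMat (s + 3) x Qs 1 = dMat (s + 3) x Qs 2 := by
    rw [dMat_succ x Qs (by omega : 1 < s + 3), hx1, zero_smul, add_zero]
  have hQ1 : Qs' 1 = Qs 2 := hQk 1 le_rfl
  refine ⟨x', Qs', ?_, rfl, hD _ (by omega), fun β L => (hlag β L 1 le_rfl).trans (hlag1 β L),
    fun β h L => ?_, fun β h => ?_⟩
  · exact
      { one_le := by omega
        x_zero := hx1
        x_mono := fun k hk => hp.x_mono (k + 1) (by omega)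
        x_le_one := hp.x_le_one
        Q_zero := if_pos rfl
        Q_last := (hQk _ (by omega)).trans hp.Q_last
        Q_mono := fun k hk => by
          rcases Nat.eq_zero_or_pos k with rfl | hk0
          · simpa [hQs'] using hp.posSemidef (k := 2) (by omega)
          · rw [hQk k hk0, hQk (k + 1) (by omega)]
            exact hp.Q_mono (k + 1) (by omega) }
  · rw [parisi, parisi, hQk (s + 2) (by omega), hlag β L 1 le_rfl, hlag1, hQ1,
      Finset.sum_eq_sum_Ico_succ_bot (by omega : 1 < s + 3),
      Finset.sum_eq_sum_Ico_succ_bot (by omega : 1 < s + 3), hx1, zero_mul, zero_add,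
      hshift _ (parisiLogTerm β (s + 3) L x Qs) 1 (s + 2) le_rfl (fun k hk => by
        rw [parisiLogTerm, parisiLogTerm, hlag β L k hk, hlag β L (k + 1) (by omega), hQk k hk,
          hQk (k + 1) (by omega)]),
      hshift _ (fun k => x k * entrySum (theta β (Qs (k + 1)) - theta β (Qs k))) 1 (s + 2) le_rfl
        (fun k hk => by rw [hQk k hk, hQk (k + 1) (by omega)])]
    -- Since `Λ_2 = Λ_1`, the limiting log term only changes `ξ'(Q_1)` to `ξ'(Q_2)` in the boundary
    -- term; likewise below, with `D_1 = D_2`.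
    have h1 : parisiLogTerm β (s + 3) L x Qs 1 =
        inn (xiDeriv β (Qs 2)) (lagr β (s + 3) L x Qs 1)⁻¹ -
          inn (xiDeriv β (Qs 1)) (lagr β (s + 3) L x Qs 1)⁻¹ := by
      rw [parisiLogTerm, if_pos hx1, inn_comm, inn_sub_left]
    rw [h1]
    ring
  · have hlog : ∑ k ∈ Finset.Ico 1 (s + 1), csLogTerm (s + 2) x' Qs' k =
        ∑ k ∈ Finset.Ico 2 (s + 2), csLogTerm (s + 3) x Qs k :=
      hshift _ _ 1 (s + 1) le_rfl fun k hk => by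
        rw [csLogTerm, csLogTerm, hD k hk, hD (k + 1) (by omega), hQk k hk,
          hQk (k + 1) (by omega)]
    have hxi : ∑ k ∈ Finset.Ico 1 (s + 2), x' k * entrySum (xi β (Qs' (k + 1)) - xi β (Qs' k)) =
        ∑ k ∈ Finset.Ico 2 (s + 3), x k * entrySum (xi β (Qs (k + 1)) - xi β (Qs k)) :=
      hshift _ _ 1 (s + 2) le_rfl fun k hk => by rw [hQk k hk, hQk (k + 1) (by omega)]
    rw [crisantiSommers, crisantiSommers, show s + 2 - 1 = s + 1 from rfl,
      show s + 3 - 1 = s + 2 from rfl, hlog, hxi, hQk (s + 2) (by omega), hQk (s + 1) (by omega),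
      show x' (s + 1) = x (s + 2) from rfl, hD 1 le_rfl, hD1, hQ1,
      Finset.sum_eq_sum_Ico_succ_bot (by omega : 1 < s + 2),
      Finset.sum_eq_sum_Ico_succ_bot (by omega : 1 < s + 3), hx1, zero_mul, zero_add]
    have h1 : csLogTerm (s + 3) x Qs 1 =
        inn (Qs 1) (dMat (s + 3) x Qs 2)⁻¹ - inn (Qs 2) (dMat (s + 3) x Qs 2)⁻¹ := by
      rw [csLogTerm, if_pos hx1, inn_comm, inn_sub_left]
      ring
    rw [h1]
    ring

/-- A path with last weight `1` can be replaced by one with positive weights, with the same values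
of both functionals. -/
lemma IsPath.exists_pos_weights {Q : Matrix (Fin n) (Fin n) ℝ} {s : ℕ} {x : ℕ → ℝ}
    {Qs : ℕ → Matrix (Fin n) (Fin n) ℝ} (hp : IsPath Q (s + 2) x Qs) (hx1 : x (s + 1) = 1) :
    ∃ (t : ℕ) (x' : ℕ → ℝ) (Qs' : ℕ → Matrix (Fin n) (Fin n) ℝ), IsPath Q (t + 2) x' Qs' ∧
      (∀ k, 1 ≤ k → k < t + 2 → 0 < x' k) ∧ x' (t + 1) = 1 ∧
      dMat (t + 2) x' Qs' (t + 1) = dMat (s + 2) x Qs (s + 1) ∧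
      (∀ β L, lagr β (t + 2) L x' Qs' 1 = lagr β (s + 2) L x Qs 1) ∧
      (∀ β h L, parisi β h (t + 2) L x' Qs' = parisi β h (s + 2) L x Qs) ∧
      ∀ β h, crisantiSommers β h (t + 2) x' Qs' = crisantiSommers β h (s + 2) x Qs := by
  induction s generalizing x Qs with
  | zero =>
    refine ⟨0, x, Qs, hp, fun k h1 h2 => ?_, hx1, rfl, fun _ _ => rfl, fun _ _ _ => rfl,
      fun _ _ => rfl⟩
    obtain rfl : k = 1 := by omega
    rw [hx1]
    exact one_pos
  | succ s ih =>
    rcases (hp.x_nonneg (by omega : 1 < s + 1 + 2)).eq_or_lt with h0 | h0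
    · obtain ⟨x₁, Qs₁, hp₁, h1, h2, h3, h4, h5⟩ := hp.drop_zero_step h0.symm
      obtain ⟨t, x', Qs', hp', g0, g1, g2, g3, g4, g5⟩ := ih hp₁ (h1.trans hx1)
      exact ⟨t, x', Qs', hp', g0, g1, g2.trans h2, fun β L => (g3 β L).trans (h3 β L),
        fun β h L => (g4 β h L).trans (h4 β h L), fun β h => (g5 β h).trans (h5 β h)⟩
    · exact ⟨s + 1, x, Qs, hp, fun k h1 h2 => h0.trans_le (hp.x_monotone h1 h2), hx1, rfl,
        fun _ _ => rfl, fun _ _ _ => rfl, fun _ _ => rfl⟩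

/-- Appending a trivial step of weight `1` does not change the Parisi functional. -/
lemma IsPath.append_one {Q : Matrix (Fin n) (Fin n) ℝ} {r : ℕ} {x : ℕ → ℝ}
    {Qs : ℕ → Matrix (Fin n) (Fin n) ℝ} (hp : IsPath Q r x Qs) :
    ∃ (x' : ℕ → ℝ) (Qs' : ℕ → Matrix (Fin n) (Fin n) ℝ), IsPath Q (r + 1) x' Qs' ∧
      x' r = 1 ∧ (∀ β L, lagr β (r + 1) L x' Qs' 1 = lagr β r L x Qs 1) ∧
      ∀ β h L, parisi β h (r + 1) L x' Qs' = parisi β h r L x Qs := by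
  set x' : ℕ → ℝ := fun k => if k < r then x k else 1 with hx'
  set Qs' : ℕ → Matrix (Fin n) (Fin n) ℝ := fun k => if k ≤ r then Qs k else Q with hQs'
  have hr := hp.one_le
  have hxk : ∀ k < r, x' k = x k := fun k hk => if_pos hk
  have hxr : x' r = 1 := if_neg (lt_irrefl r)
  have hQk : ∀ k ≤ r, Qs' k = Qs k := fun k hk => if_pos hk
  have hQr : Qs' (r + 1) = Qs r := (if_neg (by omega)).trans hp.Q_last.symm
  have hlag : ∀ β L p, p ≤ r → lagr β (r + 1) L x' Qs' p = lagr β r L x Qs p := fun β L p h1 => by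
    rw [lagr, lagr, Finset.sum_Ico_succ_top h1, hQr, hQk r le_rfl, sub_self, smul_zero, add_zero]
    congr 1
    refine Finset.sum_congr rfl fun k hk => ?_
    rw [Finset.mem_Ico] at hk
    rw [hxk k hk.2, hQk k hk.2.le, hQk (k + 1) hk.2]
  refine ⟨x', Qs', ?_, hxr, fun β L => hlag β L 1 hr, fun β h L => ?_⟩
  · exact
      { one_le := by omega
        x_zero := (hxk 0 hr).trans hp.x_zero
        x_mono := fun k hk => by
          rw [hxk k (by omega)]
          rcases Nat.lt_succ_iff_lt_or_eq.1 hk with h1 | h1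
          · rw [hxk _ h1]
            exact hp.x_mono k h1
          · rw [h1, hxr]
            exact hp.x_le (by omega)
        x_le_one := hxr.le
        Q_zero := (hQk 0 (by omega)).trans hp.Q_zero
        Q_last := hQr.trans hp.Q_last
        Q_mono := fun k hk => by
          rcases Nat.lt_succ_iff_lt_or_eq.1 hk with h1 | rfl
          · rw [hQk k h1.le, hQk (k + 1) h1]
            exact hp.Q_mono k h1
          · rw [hQr, hQk k le_rfl, sub_self]
            exact Matrix.PosSemidef.zero }
  · have h0 : parisiLogTerm β (r + 1) L x' Qs' r = 0 := by
      rw [parisiLogTerm, hxr, if_neg one_ne_zero, lagr_last, hlag β L r le_rfl, lagr_last]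
      -- If `|L| = 0`, the default values `0 / 0 = 0` and `log 0 = 0` still make the term vanish.
      rcases eq_or_ne L.det 0 with h1 | h1
      · simp [h1]
      · simp [div_self h1]
    have hlog : ∑ k ∈ Finset.Ico 1 r, parisiLogTerm β (r + 1) L x' Qs' k =
        ∑ k ∈ Finset.Ico 1 r, parisiLogTerm β r L x Qs k := Finset.sum_congr rfl fun k hk => by
      rw [Finset.mem_Ico] at hk
      rw [parisiLogTerm, parisiLogTerm, hlag β L k hk.2.le, hlag β L (k + 1) hk.2, hxk k hk.2,
        hQk k hk.2.le, hQk (k + 1) hk.2]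
    have htheta : ∑ k ∈ Finset.Ico 1 r,
          x' k * entrySum (theta β (Qs' (k + 1)) - theta β (Qs' k)) =
        ∑ k ∈ Finset.Ico 1 r, x k * entrySum (theta β (Qs (k + 1)) - theta β (Qs k)) :=
      Finset.sum_congr rfl fun k hk => by
        rw [Finset.mem_Ico] at hk
        rw [hxk k hk.2, hQk k hk.2.le, hQk (k + 1) hk.2]
    rw [parisi, parisi, hlag β L 1 hr, hQr, hQk 1 hr, Finset.sum_Ico_succ_top hr,
      Finset.sum_Ico_succ_top hr, h0, hlog, htheta, hQr, hQk r le_rfl, entrySum_sub, sub_self,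
      mul_zero, add_zero, add_zero]

/-- Every value of the Parisi functional is attained along a path with positive weights and last
weight `1`. -/
lemma exists_pos_weights_of_mem_parisiValues {β : ℕ → Fin n → ℝ} {h : Fin n → ℝ}
    {Q : Matrix (Fin n) (Fin n) ℝ} {v : ℝ} (hv : v ∈ parisiValues β h Q) :
    ∃ (s : ℕ) (L : Matrix (Fin n) (Fin n) ℝ) (x : ℕ → ℝ) (Qs : ℕ → Matrix (Fin n) (Fin n) ℝ),
      IsPath Q (s + 2) x Qs ∧ (∀ k, 1 ≤ k → k < s + 2 → 0 < x k) ∧ x (s + 1) = 1 ∧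
      (lagr β (s + 2) L x Qs 1).PosDef ∧ v = parisi β h (s + 2) L x Qs := by
  obtain ⟨r, L, x, Qs, hp, -, hL, rfl⟩ := hv
  obtain ⟨s, rfl⟩ : ∃ s, r = s + 1 := ⟨r - 1, by have := hp.one_le; omega⟩
  obtain ⟨x₁, Qs₁, hp₁, h1, h2, h3⟩ := hp.append_one
  obtain ⟨t, x', Qs', hp', g0, g1, -, g3, g4, -⟩ := hp₁.exists_pos_weights h1
  refine ⟨t, L, x', Qs', hp', g0, g1, ?_, ?_⟩
  · rw [g3]
    exact h2 β L ▸ hL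
  · exact ((g4 β h L).trans (h3 β h L)).symm

/-! ### Nonemptiness, and the theorem. -/

lemma parisiValues_nonempty (β : ℕ → Fin n → ℝ) (h : Fin n → ℝ)
    {Q : Matrix (Fin n) (Fin n) ℝ} (hQ : Q.PosDef) : (parisiValues β h Q).Nonempty := by
  refine ⟨_, 1, 1, fun _ => 0, fun k => if k = 0 then 0 else Q, ?_, Matrix.PosSemidef.one, ?_, rfl⟩
  · exact
      { one_le := le_rfl
        x_zero := rfl
        x_mono := fun _ _ => le_rfl
        x_le_one := zero_le_one
        Q_zero := if_pos rfl
        Q_last := if_neg one_ne_zero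
        Q_mono := fun k hk => by
          obtain rfl : k = 0 := by omega
          simpa using hQ.posSemidef }
  · rw [lagr_last]
    exact Matrix.PosDef.one

lemma csValues_nonempty (β : ℕ → Fin n → ℝ) (h : Fin n → ℝ)
    {Q : Matrix (Fin n) (Fin n) ℝ} (hQ : Q.PosDef) : (csValues β h Q).Nonempty := by
  refine ⟨_, 2, fun k => if k = 0 then 0 else 1, fun k => if k ≤ 1 then 0 else Q, ?_,
    if_neg one_ne_zero, ?_, rfl⟩
  · exact
      { one_le := one_le_two
        x_zero := if_pos rfl
        x_mono := fun k hk => by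
          obtain rfl : k = 0 := by omega
          simp
        x_le_one := by simp
        Q_zero := if_pos zero_le_one
        Q_last := if_neg (by omega)
        Q_mono := fun k hk => by
          obtain rfl | rfl : k = 0 ∨ k = 1 := by omega
          · simpa using Matrix.PosSemidef.zero
          · simpa using hQ.posSemidef }
  · simpa [dMat] using hQ.det_pos

end VectorSpin

theorem mainTheorem2 (n : ℕ) (hn : 1 ≤ n)
    (β : ℕ → Fin n → ℝ)
    (hβ_sum : ∀ j, Summable fun p : ℕ => (2 : ℝ) ^ p * β p j ^ 2)
    (hβ_odd : ∀ p, 2 ≤ p → Odd p → β p = 0)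
    (hβ_sign : ∀ p, 2 ≤ p → ∀ i j, 0 ≤ β p i * β p j)
    (h : Fin n → ℝ)
    (Q : Matrix (Fin n) (Fin n) ℝ) (hQ : Q.PosDef) (hQ_diag : ∀ j, Q j j = 1) :
    (VectorSpin.parisiValues β h Q).Nonempty ∧ BddBelow (VectorSpin.parisiValues β h Q) ∧
      (VectorSpin.csValues β h Q).Nonempty ∧ BddBelow (VectorSpin.csValues β h Q) ∧
      sInf (VectorSpin.parisiValues β h Q) = sInf (VectorSpin.csValues β h Q) := by
  open VectorSpin in
  have hP := parisiValues_nonempty β h hQ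
  have hC := csValues_nonempty β h hQ
  have hPC : ∀ v ∈ csValues β h Q, ∃ w ∈ parisiValues β h Q, w ≤ v := by
    rintro v ⟨r, x, Qs, hp, hx1, hD, rfl⟩
    obtain ⟨s, rfl⟩ : ∃ s, r = s + 2 := by
      refine ⟨r - 2, ?_⟩
      have h1 := hp.one_le
      have h2 : r ≠ 1 := by
        rintro rfl
        exact zero_ne_one (hp.x_zero.symm.trans hx1)
      omega
    obtain ⟨t, x', Qs', hp', g0, g1, g2, -, -, g5⟩ := hp.exists_pos_weights hx1
    rw [← g5]
    exact hp'.exists_parisi_le hβ_sum h hQ_diag g0 g1 (g2 ▸ hD)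
  have hCP : ∀ v ∈ parisiValues β h Q, ∃ w ∈ csValues β h Q, w ≤ v := by
    intro v hv
    obtain ⟨s, L, x, Qs, hp, hx, hx1, hL, rfl⟩ := exists_pos_weights_of_mem_parisiValues hv
    exact hp.exists_crisantiSommers_le hβ_sum hβ_odd hβ_sign h hQ hQ_diag hx hx1 hL
  have hPb : BddBelow (parisiValues β h Q) := by
    refine ⟨(Real.log Q.det - entrySum (theta β Q)) / 2, fun v hv => ?_⟩
    obtain ⟨s, L, x, Qs, hp, hx, -, hL, rfl⟩ := exists_pos_weights_of_mem_parisiValues hv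
    linarith [hp.log_det_sub_theta_le hβ_sum hβ_odd hβ_sign h hQ hQ_diag hx hL]
  -- Every value of 𝒞 dominates a value of 𝒫, so the bound for 𝒫 carries over.
  have hCb : BddBelow (csValues β h Q) := by
    obtain ⟨b, hb⟩ := hPb
    refine ⟨b, fun v hv => ?_⟩
    obtain ⟨w, hw, hwv⟩ := hPC v hv
    exact (hb hw).trans hwv
  refine ⟨hP, hPb, hC, hCb, le_antisymm ?_ ?_⟩
  · refine le_csInf hC fun v hv => ?_
    obtain ⟨w, hw, hwv⟩ := hPC v hv
    exact (csInf_le hPb hw).trans hwv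
  · refine le_csInf hP fun v hv => ?_
    obtain ⟨w, hw, hwv⟩ := hCP v hv
    exact (csInf_le hCb hw).trans hwv
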